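/- **Stronger first-order convergence of the stochastic trust-region SQP method TR-SQP-STORM.** *Problem.* Consider $\min_{x\in\mathbb R^d} f(x)$ subject to $c(x)=0$, with $f:\mathbb R^d\to\mathbb R$ (for instance $f(x)=\mathbb E[F(x;\xi)]$) and $c:\mathbb R^d\to\mathbb R^m$. Let $G=\nabla c\in\mathbb R^{m\times d}$ be the Jacobian, $P=I-G^T[GG^T]^{-1}G$, and let $\|\cdot\|$ be the $\ell_2$/operator norm. A subscript $k$ denotes evaluation at $x_k$; $g_k=\nabla f(x_k)$. Let $\lambda_k=-[G_kG_k^T]^{-1}G_kg_k$ and $\nabla\mathcal L_k=(g_k+G_k^T\lambda_k,\;c_k)$; $\|\nabla\mathcal L_k\|$ is the KKT residual. *Parameters.* $\alpha\in\{0,1\}$; $p_h,p_g,p_f,\eta\in(0,1)$; $\kappa_{fcd}\in(0,1]$; $r,\Delta_{\max},\kappa_h,\kappa_g>0$; $0<\kappa_f\le\kappa_{fcd}\eta^3/(16\max\{1,\Delta_{\max}\})$; $\rho,\gamma>1$; $x_0\in\mathbb R^d$, $\Delta_0\in(0,\Delta_{\max})$, $\bar\epsilon_0,\bar\mu_0>0$.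 *Algorithm.* For $k=0,1,\dots$, given $(x_k,\Delta_k,\bar\epsilon_k,\bar\mu)$, where $\bar\mu$ is the current merit parameter: 1. Draw a gradient estimate $\bar g_k$; put $\bar\lambda_k=-[G_kG_k^T]^{-1}G_k\bar g_k$, $\bar\nabla_x\mathcal L_k=\bar g_k+G_k^T\bar\lambda_k$, $\bar\nabla\mathcal L_k=(\bar\nabla_x\mathcal L_k,c_k)$. Let $Z_k\in\mathbb R^{d\times(d-m)}$ satisfy $Z_k^TZ_k=I$, $Z_kZ_k^T=P_k$. If $\alpha=0$, take any matrix $\bar H_k$ and put $\bar\tau_k^+=0$. If $\alpha=1$, draw a symmetric estimate $\bar\nabla^2f_k$, put $\bar H_k=\bar\nabla^2f_k+\sum_i\bar\lambda_k^i\nabla^2c_k^i$ and $\bar\tau_k^+=|\min\{\bar\tau_k,0\}|$, with $\bar\tau_k$ the smallest eigenvalue of $Z_k^T\bar H_kZ_k$ ($\bar\tau_k^+=0$ if $d=m$). 2. If $\max\{\|\bar\nabla\mathcal L_k\|/\max\{1,\|\bar H_k\|\},\bar\tau_k^+\}<\eta\Delta_k$, the iteration is unsuccessful: $x_{k+1}=x_k$,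 $\Delta_{k+1}=\Delta_k/\gamma$, $\bar\epsilon_{k+1}=\bar\epsilon_k/\gamma$, and the merit parameter is kept ($\bar\mu_k=\bar\mu$). Otherwise compute a trial step $\Delta x_k=w_k+Z_ku_k$ as follows. (Throughout, $b/0=+\infty$ in $\min\{a,b/0\}$.) Let $c^{RS}_k=c_k/\|G_k\|$, $\bar\nabla_x\mathcal L^{RS}_k=\bar\nabla_x\mathcal L_k/\|\bar H_k\|$, $\bar\tau^{RS+}_k=\bar\tau^+_k/\|\bar H_k\|$ (with $c_k^{RS}=0$ if $m=0$). If $$\|\bar\nabla\mathcal L_k\|\min\{\Delta_k,\|\bar\nabla\mathcal L_k\|/\|\bar H_k\|\}\ge\bar\tau_k^+\Delta_k(\Delta_k+\|c_k\|),$$ $\Delta x_k$ is a gradient step with radii $\breve\Delta_k,\tilde\Delta_k$ equal to $\Delta_k$ times $\|c_k^{RS}\|$, resp. $\|\bar\nabla_x\mathcal L_k^{RS}\|$, divided by $\|(\bar\nabla_x\mathcal L_k^{RS},c_k^{RS})\|$. When $\bar H_k=0$: $\breve\Delta_k=0$ and $\tilde\Delta_k=\Delta_k$ if $\bar\nabla_x\mathcal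 L_k\ne0$, whereas if $\bar\nabla_x\mathcal L_k=0$ then $\bar\nabla_x\mathcal L_k^{RS}$ is read as $0$. Otherwise $\Delta x_k$ is an eigen step with radii equal to $\Delta_k$ times $\|c_k^{RS}\|$, resp. $\bar\tau_k^{RS+}$, divided by $\|(c_k^{RS},\bar\tau_k^{RS+})\|$. In both cases $v_k=-G_k^T[G_kG_k^T]^{-1}c_k$, $w_k=\min\{\breve\Delta_k/\|v_k\|,1\}v_k$ and $\|u_k\|\le\tilde\Delta_k$. With $h_k=\bar g_k+\bar H_kw_k$ and $m(u)=\frac12(Z_ku)^T\bar H_kZ_ku+h_k^TZ_ku$, a gradient step satisfies $$m(u_k)-m(0)\le-\tfrac{\kappa_{fcd}}2\|Z_k^Th_k\|\min\Big\{\tilde\Delta_k,\frac{\|Z_k^Th_k\|}{\|Z_k^T\bar H_kZ_k\|}\Big\},$$ and an eigen step satisfies $h_k^TZ_ku_k\le0$ and $(Z_ku_k)^T\bar H_kZ_ku_k\le-\kappa_{fcd}\bar\tau_k^+\tilde\Delta_k^2$. 3. Let $\mathrm{Pred}_k=\bar g_k^T\Delta x_k+\frac12\Delta x_k^T\bar H_k\Delta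 x_k+\bar\mu_k(\|c_k+G_k\Delta x_k\|-\|c_k\|)$, where $\bar\mu_k=\rho^j\bar\mu$ with the least integer $j\ge0$ such that $$\mathrm{Pred}_k\le-\tfrac{\kappa_{fcd}}2\max\big\{\|\bar\nabla\mathcal L_k\|\min\{\Delta_k,\|\bar\nabla\mathcal L_k\|/\|\bar H_k\|\},\;\bar\tau_k^+\Delta_k(\Delta_k+\|c_k\|)\big\}.$$ Put $x_{s_k}=x_k+\Delta x_k$, draw estimates $\bar f_k,\bar f_{s_k}$ of $f(x_k),f(x_{s_k})$, and let $\mathrm{Ared}_k=\bar f_{s_k}-\bar f_k+\bar\mu_k(\|c(x_{s_k})\|-\|c_k\|)$. 4. If $\mathrm{Ared}_k/\mathrm{Pred}_k<\eta$, $\alpha=1$ and $\|c_k\|\le r$, perform a second-order correction (SOC): put $d_k=-G_k^T[G_kG_k^T]^{-1}\{c(x_k+\Delta x_k)-c_k-G_k\Delta x_k\}$, replace $x_{s_k}$ by $x_k+\Delta x_k+d_k$, draw a new $\bar f_{s_k}$ and recompute $\mathrm{Ared}_k$. If now $\mathrm{Ared}_k/\mathrm{Pred}_k\ge\eta$, the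 iteration is successful: $x_{k+1}=x_{s_k}$, $\Delta_{k+1}=\min\{\gamma\Delta_k,\Delta_{\max}\}$, and $\bar\epsilon_{k+1}=\gamma\bar\epsilon_k$ if $-\mathrm{Pred}_k\ge\bar\epsilon_k$, $\bar\epsilon_{k+1}=\bar\epsilon_k/\gamma$ otherwise. If not, it is unsuccessful: $x_{k+1}=x_k$, $\Delta_{k+1}=\Delta_k/\gamma$, $\bar\epsilon_{k+1}=\bar\epsilon_k/\gamma$. In every case $\bar\mu_k$ is the current merit parameter for iteration $k+1$. *Random models.* Let $\mathcal F_{-1}\subseteq\mathcal F_{-0.5}\subseteq\mathcal F_0\subseteq\mathcal F_{0.5}\subseteq\cdots$ be $\sigma$-algebras such that $\mathcal F_{k-1}$ contains the randomness before iteration $k$ ($x_k,\Delta_k,\bar\epsilon_k$ and all function-value estimates drawn in earlier iterations are $\mathcal F_{k-1}$-measurable) and $\bar g_k,\bar\nabla^2f_k,\bar H_k,\Delta x_k,\bar\mu_k$ are $\mathcal F_{k-0.5}$-measurable. For all $k$, almost surely: - if $\alpha=1$: $P(\|\bar\nabla^2f_k-\nabla^2f_k\|\le\kappa_h\Delta_k\mid\mathcal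 F_{k-1})\ge1-p_h$; - $P(\|\bar g_k-g_k\|\le\kappa_g\Delta_k^{\alpha+1}\mid\mathcal F_{k-1})\ge1-p_g$; - conditionally on $\mathcal F_{k-0.5}$, with probability at least $1-p_f$ the first pair of value estimates satisfies $\max\{|\bar f_k-f(x_k)|,|\bar f_{s_k}-f(x_{s_k})|\}\le\kappa_f\Delta_k^{\alpha+2}$; and, with probability at least $1-p_f$, the redrawn estimate satisfies $|\bar f_{s_k}-f(x_{s_k})|\le\kappa_f\Delta_k^{\alpha+2}$ at the corrected trial point. Each event is taken to hold when the corresponding estimates are not drawn; - $\mathbb E[|\bar f_k-f(x_k)|^2\mid\mathcal F_{k-0.5}]\le\bar\epsilon_k^2$ and $\mathbb E[|\bar f_{s_k}-f(x_{s_k})|^2\mid\mathcal F_{k-0.5}]\le\bar\epsilon_k^2$, the latter both for the first trial point and for the final one (the corrected point with its redrawn estimate if the SOC is performed, the first trial point if not). Errors count as $0$ when no estimates are drawn, and the squared errors are integrable. *Assumptions.* (i) There is an open convex set $\mathcal O\subseteq\mathbb R^d$ containing all iterates and trial points, on which $f$ and $c$ are twice continuously differentiable, $f\ge f_{\inf}$,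 and $\nabla f,\nabla^2f,G,\nabla^2c^i$ ($1\le i\le m$) are Lipschitz with constants $L_{\nabla f},L_{\nabla^2f},L_G,L_{\nabla^2c}$. There are $\kappa_c,\kappa_{\nabla f},\kappa_{1,G},\kappa_{2,G}>0$ with $\|c_k\|\le\kappa_c$, $\|g_k\|\le\kappa_{\nabla f}$, $\kappa_{1,G}I\preceq G_kG_k^T\preceq\kappa_{2,G}I$ for all $k$. If $\alpha=0$, then $\|\bar H_k\|\le\kappa_B$ for all $k$ with a constant $\kappa_B\ge1$. (ii) There are a possibly random $\bar K<\infty$ and a deterministic $\hat\mu$ with $\bar\mu_k=\bar\mu_{\bar K}\le\hat\mu$ for all $k\ge\bar K$. (The pathwise statements in (i), (ii) and the algorithm are required almost surely.) *Constants.* If $\alpha=1$, let $\kappa_B=\max\{1,\kappa_h\Delta_{\max}+L_{\nabla f}+\frac{\sqrt mL_G}{\sqrt{\kappa_{1,G}}}(\kappa_g\Delta_{\max}^2+\kappa_{\nabla f})\}$. With $M=\max\{1,\Delta_{\max}\}$ let $\Upsilon_1=\kappa_gM+\frac12(L_{\nabla f}+\kappa_B+\hat\mu L_G)$ and $$\Upsilon_3=\frac{3\kappa_{fcd}}8\max\Big\{\frac{\kappa_B}{\kappa_gM+\kappa_B},\frac{4\kappa_fM+8\Upsilon_1}{\{(1-\eta)\kappa_{fcd}\kappa_g+4\kappa_f\}M+8\Upsilon_1}\Big\}.$$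 **Theorem.** Suppose that (i), (ii) and the above conditions on the random models hold and that, for some $\nu\in(0,1)$ with $$\frac\nu{1-\nu}\ge\max\Big\{\frac{4\gamma^3M}{\min\{\eta^3\kappa_{fcd},\Upsilon_3\}},\frac{2\gamma}\eta\Big\},\qquad\text{we have}\qquad p_h+p_g+2p_f\le\frac{(1-\nu)^2}{16\nu^2}\Big(1-\frac1\gamma\Big)^2.$$ Then $\lim_{k\to\infty}\|\nabla\mathcal L_k\|=0$ almost surely. -/

import Mathlib

open Filter Topology MeasureTheory ProbabilityTheory
open scoped NNReal InnerProductSpace Gradient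

noncomputable section

namespace TRSQP

/-- `n`-dimensional Euclidean space with the `ℓ²` norm. Matrices are represented by continuous
linear maps between such spaces, so that `‖A‖` is the operator norm and `A.adjoint` is `Aᵀ`. -/
abbrev Vec (n : ℕ) : Type := EuclideanSpace ℝ (Fin n)

/-- `min {a, b / c}`, with the convention `b / 0 = +∞`. -/
def minRatio (a b c : ℝ) : ℝ := if c = 0 then a else min a (b / c)

/-- The `ℓ²` norm of the stacked vector `(a, b)`. -/
def pairNorm {E F : Type*} [NormedAddCommGroup E] [NormedAddCommGroup F] (a : E) (b : F) : ℝ :=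
  ‖(WithLp.toLp 2 (a, b) : WithLp 2 (E × F))‖

/-- The Hessian `∇²φ(x)`, the derivative of the gradient. -/
def hessian {d : ℕ} (φ : Vec d → ℝ) (x : Vec d) : Vec d →L[ℝ] Vec d :=
  fderiv ℝ (gradient φ) x

/-- The smallest (real) eigenvalue of a matrix; it is used for symmetric matrices only.
For the empty `0 × 0` matrix, which has no eigenvalue, the value is `0`. -/
def smallestEigenvalue {n : ℕ} (A : Vec n →L[ℝ] Vec n) : ℝ :=
  sInf {t : ℝ | Module.End.HasEigenvalue (A : Vec n →ₗ[ℝ] Vec n) t}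

/-- The problem `min f(x)` subject to `c(x) = 0`. -/
structure Problem (d m : ℕ) where
  f : Vec d → ℝ
  c : Vec d → Vec m

namespace Problem

variable {d m : ℕ} (p : Problem d m)

/-- The Jacobian `G(x)` of the constraints. -/
def jac (x : Vec d) : Vec d →L[ℝ] Vec m := fderiv ℝ p.c x

/-- `[G(x) G(x)ᵀ]⁻¹`. -/
def gramInv (x : Vec d) : Vec m →L[ℝ] Vec m :=
  ContinuousLinearMap.inverse ((p.jac x).comp (p.jac x).adjoint)

/-- The projection `P(x) = I - G(x)ᵀ [G(x) G(x)ᵀ]⁻¹ G(x)` onto the kernel of `G(x)`. -/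
def proj (x : Vec d) : Vec d →L[ℝ] Vec d :=
  ContinuousLinearMap.id ℝ (Vec d) -
    (p.jac x).adjoint.comp ((p.gramInv x).comp (p.jac x))

/-- The least-squares multiplier `-[G Gᵀ]⁻¹ G g` at `x` that belongs to the (true or estimated)
objective gradient `g`. -/
def multiplier (x g : Vec d) : Vec m := -(p.gramInv x (p.jac x g))

/-- The (true or estimated) gradient in `x` of the Lagrangian, `g + Gᵀ λ`, with `λ` the
multiplier of `g`. -/
def lagGrad (x g : Vec d) : Vec d := g + (p.jac x).adjoint (p.multiplier x g)

/-- The norm of the full (true or estimated) Lagrangian gradient `(g + Gᵀ λ, c(x))`. -/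
def kktNorm (x g : Vec d) : ℝ := pairNorm (p.lagGrad x g) (p.c x)

/-- The KKT residual `‖∇L‖` at `x`, computed from the true gradient of `f`. -/
def kktResidual (x : Vec d) : ℝ := p.kktNorm x (gradient p.f x)

end Problem

/-- User-specified parameters of the method; `α = 0` aims at first-order and `α = 1` at
second-order stationary points. -/
structure Params where
  α : Fin 2
  ph : ℝ
  pg : ℝ
  pf : ℝ
  η : ℝ
  κfcd : ℝ
  r : ℝ
  Δmax : ℝ
  κh : ℝ
  κg : ℝ
  κf : ℝ
  ρ : ℝ
  γ : ℝ
  /-- initial trust-region radius -/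
  Δ₀ : ℝ
  /-- initial reliability parameter -/
  ε₀ : ℝ
  /-- initial merit parameter -/
  μ₀ : ℝ

/-- The admissible range of the parameters. -/
structure Params.Valid (q : Params) : Prop where
  ph_mem : q.ph ∈ Set.Ioo (0 : ℝ) 1
  pg_mem : q.pg ∈ Set.Ioo (0 : ℝ) 1
  pf_mem : q.pf ∈ Set.Ioo (0 : ℝ) 1
  η_mem : q.η ∈ Set.Ioo (0 : ℝ) 1
  κfcd_mem : q.κfcd ∈ Set.Ioc (0 : ℝ) 1
  r_pos : 0 < q.r
  Δmax_pos : 0 < q.Δmax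
  κh_pos : 0 < q.κh
  κg_pos : 0 < q.κg
  κf_pos : 0 < q.κf
  κf_le : q.κf ≤ q.κfcd * q.η ^ 3 / (16 * max 1 q.Δmax)
  one_lt_ρ : 1 < q.ρ
  one_lt_γ : 1 < q.γ
  Δ₀_mem : q.Δ₀ ∈ Set.Ioo 0 q.Δmax
  ε₀_pos : 0 < q.ε₀
  μ₀_pos : 0 < q.μ₀

/-- The data of one iteration: the state on entry, the estimates that are drawn, the orthonormal
basis of the kernel, the tangential step in that basis, and the selected merit parameter.
The estimates of function values are used only if the algorithm asks for them. -/
structure Iteration (d m : ℕ) where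
  /-- iterate -/
  x : Vec d
  /-- trust-region radius -/
  Δ : ℝ
  /-- reliability parameter -/
  ε : ℝ
  /-- merit parameter on entry to the iteration -/
  μin : ℝ
  /-- gradient estimate -/
  g : Vec d
  /-- estimate of the Hessian of the objective (used only if `α = 1`) -/
  hessF : Vec d →L[ℝ] Vec d
  /-- approximation of the Hessian of the Lagrangian -/
  H : Vec d →L[ℝ] Vec d
  /-- orthonormal basis of the kernel of the Jacobian -/
  Z : Vec (d - m) →L[ℝ] Vec d
  /-- tangential step in the basis `Z` -/
  u : Vec (d - m)
  /-- merit parameter selected in the iteration -/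
  μ : ℝ
  /-- estimate of `f` at the iterate -/
  fx : ℝ
  /-- estimate of `f` at the first trial point -/
  fs : ℝ
  /-- new estimate of `f` at the corrected trial point (used only if the second-order
  correction step is performed) -/
  fsoc : ℝ

namespace Iteration

variable {d m : ℕ} (p : Problem d m) (q : Params) (it : Iteration d m)

/-! Quantities of Step 1. -/

/-- Estimated gradient in `x` of the Lagrangian. -/
def lagGradEst : Vec d := p.lagGrad it.x it.g

/-- Norm of the estimated full Lagrangian gradient. -/
def kktEst : ℝ := p.kktNorm it.x it.g

/-- `Zᵀ H Z`. -/
def reducedHess : Vec (d - m) →L[ℝ] Vec (d - m) := it.Z.adjoint.comp (it.H.comp it.Z)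

/-- Negative curvature `|min {τ, 0}|` if `α = 1`, and `0` if `α = 0`. -/
def τplus : ℝ := if q.α = 1 then |min (smallestEigenvalue it.reducedHess) 0| else 0

/-! Quantities of Step 2. -/

/-- The test whose failure makes the iteration unsuccessful before a step is computed. -/
def Accepts : Prop := q.η * it.Δ ≤ max (it.kktEst p / max 1 ‖it.H‖) (it.τplus q)

/-- `‖∇L‖ min {Δ, ‖∇L‖ / ‖H‖}` for the estimated quantities. -/
def gradReduction : ℝ := it.kktEst p * minRatio it.Δ (it.kktEst p) ‖it.H‖

/-- `τ⁺ Δ (Δ + ‖c‖)`. -/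
def eigenReduction : ℝ := it.τplus q * it.Δ * (it.Δ + ‖p.c it.x‖)

/-- The step is a gradient step if this holds and an eigen step otherwise. -/
def IsGradStep : Prop := it.eigenReduction p q ≤ it.gradReduction p

/-- Rescaled feasibility residual `c / ‖G‖`. -/
def cRS : Vec m := ‖p.jac it.x‖⁻¹ • p.c it.x

/-- Rescaled optimality residual (for `H ≠ 0`). -/
def lagGradRS : Vec d := ‖it.H‖⁻¹ • it.lagGradEst p

/-- Rescaled negative curvature. -/
def τplusRS : ℝ := it.τplus q / ‖it.H‖

open scoped Classical in
/-- Radius for the normal step. If `H = 0` while the optimality residual is nonzero, then the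
rescaled optimality residual is infinite and its share of the radius is everything. -/
def normalRadius : ℝ :=
  if it.IsGradStep p q then
    if it.H = 0 ∧ it.lagGradEst p ≠ 0 then 0
    else ‖it.cRS p‖ / pairNorm (it.lagGradRS p) (it.cRS p) * it.Δ
  else ‖it.cRS p‖ / pairNorm (it.cRS p) (it.τplusRS q) * it.Δ

open scoped Classical in
/-- Radius for the tangential step, with the same convention if `H = 0`. -/
def tangentialRadius : ℝ :=
  if it.IsGradStep p q then
    if it.H = 0 ∧ it.lagGradEst p ≠ 0 then it.Δ
    else ‖it.lagGradRS p‖ / pairNorm (it.lagGradRS p) (it.cRS p) * it.Δ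
  else it.τplusRS q / pairNorm (it.cRS p) (it.τplusRS q) * it.Δ

/-- `v = -Gᵀ [G Gᵀ]⁻¹ c`. -/
def v : Vec d := -((p.jac it.x).adjoint (p.gramInv it.x (p.c it.x)))

/-- Normal step: `v` scaled by `min {normal radius / ‖v‖, 1}`. -/
def normalStep : Vec d := minRatio 1 (it.normalRadius p q) ‖it.v p‖ • it.v p

/-- Trial step: normal step plus tangential step. -/
def step : Vec d := it.normalStep p q + it.Z it.u

/-- `g + H w`, with `w` the normal step. -/
def modelGrad : Vec d := it.g + it.H (it.normalStep p q)

/-- The model `½ (Zu)ᵀ H (Zu) + (g + H w)ᵀ Z u` of the tangential subproblem. -/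
def model (u : Vec (d - m)) : ℝ :=
  1 / 2 * ⟪it.Z u, it.H (it.Z u)⟫_ℝ + ⟪it.modelGrad p q, it.Z u⟫_ℝ

/-- The fraction of Cauchy decrease required of a gradient step. -/
def GradStepCond : Prop :=
  ‖it.u‖ ≤ it.tangentialRadius p q ∧
  it.model p q it.u - it.model p q 0 ≤
    -(q.κfcd / 2) * ‖it.Z.adjoint (it.modelGrad p q)‖ *
      minRatio (it.tangentialRadius p q) ‖it.Z.adjoint (it.modelGrad p q)‖ ‖it.reducedHess‖

/-- The curvature condition required of an eigen step. -/
def EigenStepCond : Prop :=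
  ⟪it.modelGrad p q, it.Z it.u⟫_ℝ ≤ 0 ∧
  ‖it.u‖ ≤ it.tangentialRadius p q ∧
  ⟪it.Z it.u, it.H (it.Z it.u)⟫_ℝ ≤ -q.κfcd * it.τplus q * it.tangentialRadius p q ^ 2

/-! Quantities of Steps 3 and 4. -/

/-- Predicted reduction for the merit parameter `μ`. -/
def predAt (μ : ℝ) : ℝ :=
  ⟪it.g, it.step p q⟫_ℝ + 1 / 2 * ⟪it.step p q, it.H (it.step p q)⟫_ℝ +
    μ * (‖p.c it.x + p.jac it.x (it.step p q)‖ - ‖p.c it.x‖)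

/-- The predicted reduction, with the selected merit parameter. -/
def pred : ℝ := it.predAt p q it.μ

/-- The bound that the predicted reduction has to meet. -/
def predBound : ℝ := -(q.κfcd / 2) * max (it.gradReduction p) (it.eigenReduction p q)

/-- First trial point. -/
def trial : Vec d := it.x + it.step p q

/-- Actual (estimated) reduction of the merit function at the first trial point. -/
def aredFirst : ℝ := it.fs - it.fx + it.μ * (‖p.c (it.trial p q)‖ - ‖p.c it.x‖)

/-- Second-order correction step. -/
def socStep : Vec d :=
  -((p.jac it.x).adjoint
    (p.gramInv it.x (p.c (it.trial p q) - p.c it.x - p.jac it.x (it.step p q))))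

/-- The second-order correction step is performed. -/
def Soc : Prop :=
  it.Accepts p q ∧ ¬ (q.η ≤ it.aredFirst p q / it.pred p q) ∧ q.α = 1 ∧ ‖p.c it.x‖ ≤ q.r

open scoped Classical in
/-- The final trial point. -/
def xs : Vec d := if it.Soc p q then it.trial p q + it.socStep p q else it.trial p q

open scoped Classical in
/-- The estimate of `f` at the final trial point. -/
def fsFinal : ℝ := if it.Soc p q then it.fsoc else it.fs

/-- Actual (estimated) reduction of the merit function at the final trial point. -/
def ared : ℝ := it.fsFinal p q - it.fx + it.μ * (‖p.c (it.xs p q)‖ - ‖p.c it.x‖)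

/-- The iteration is successful. -/
def Successful : Prop := it.Accepts p q ∧ q.η ≤ it.ared p q / it.pred p q

/-- Condition (b) on a successful iteration to be reliable. -/
def Reliable : Prop := it.ε ≤ -(it.pred p q)

/-- The data of the iteration comply with Steps 1, 2 and 3. -/
structure Valid : Prop where
  Z_orthonormal : it.Z.adjoint.comp it.Z = ContinuousLinearMap.id ℝ (Vec (d - m))
  Z_range : it.Z.comp it.Z.adjoint = p.proj it.x
  hessF_symm : q.α = 1 → IsSelfAdjoint it.hessF
  H_eq : q.α = 1 →
    it.H = it.hessF +
      ∑ i : Fin m, p.multiplier it.x it.g i • hessian (fun y => p.c y i) it.x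
  gradStep : it.Accepts p q → it.IsGradStep p q → it.GradStepCond p q
  eigenStep : it.Accepts p q → ¬ it.IsGradStep p q → it.EigenStepCond p q
  merit : it.Accepts p q →
    ∃ j : ℕ, IsLeast {i : ℕ | it.predAt p q (q.ρ ^ i * it.μin) ≤ it.predBound p q} j ∧
      it.μ = q.ρ ^ j * it.μin
  merit_skip : ¬ it.Accepts p q → it.μ = it.μin

/-- The state on entry to the next iteration `nx` is the one that Step 4 prescribes. -/
structure Next (nx : Iteration d m) : Prop where
  μin_eq : nx.μin = it.μ
  x_succ : it.Successful p q → nx.x = it.xs p q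
  Δ_succ : it.Successful p q → nx.Δ = min (q.γ * it.Δ) q.Δmax
  ε_reliable : it.Successful p q → it.Reliable p q → nx.ε = q.γ * it.ε
  ε_unreliable : it.Successful p q → ¬ it.Reliable p q → nx.ε = it.ε / q.γ
  x_unsucc : ¬ it.Successful p q → nx.x = it.x
  Δ_unsucc : ¬ it.Successful p q → nx.Δ = it.Δ / q.γ
  ε_unsucc : ¬ it.Successful p q → nx.ε = it.ε / q.γ

/-! Accuracy of the estimates. -/

/-- Accurate Hessian estimate. -/
def HessAccurate : Prop := ‖it.hessF - hessian p.f it.x‖ ≤ q.κh * it.Δ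

/-- Accurate gradient estimate. -/
def GradAccurate : Prop := ‖it.g - gradient p.f it.x‖ ≤ q.κg * it.Δ ^ ((q.α : ℕ) + 1)

/-- Accurate estimates of `f` at the iterate and the first trial point. It holds by convention
if no such estimates are drawn. -/
def ValueAccurate : Prop :=
  it.Accepts p q →
    max |it.fx - p.f it.x| |it.fs - p.f (it.trial p q)| ≤ q.κf * it.Δ ^ ((q.α : ℕ) + 2)

/-- Accurate new estimate of `f` at the corrected trial point. It holds by convention if the
second-order correction step is not performed. -/
def SocValueAccurate : Prop :=
  it.Soc p q →
    |it.fsoc - p.f (it.trial p q + it.socStep p q)| ≤ q.κf * it.Δ ^ ((q.α : ℕ) + 2)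

open scoped Classical in
/-- Error of the estimate of `f` at the iterate (`0` if no estimate is drawn). -/
def errX : ℝ := if it.Accepts p q then |it.fx - p.f it.x| else 0

open scoped Classical in
/-- Error of the estimate of `f` at the first trial point (`0` if no estimate is drawn). -/
def errTrial : ℝ := if it.Accepts p q then |it.fs - p.f (it.trial p q)| else 0

open scoped Classical in
/-- Error of the estimate of `f` at the final trial point (`0` if no estimate is drawn). -/
def errFinal : ℝ := if it.Accepts p q then |it.fsFinal p q - p.f (it.xs p q)| else 0

end Iteration

/-- The sequence `T` of iterations is an execution of the algorithm started at `x₀`. -/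
structure IsRun {d m : ℕ} (p : Problem d m) (q : Params) (x₀ : Vec d)
    (T : ℕ → Iteration d m) : Prop where
  init_x : (T 0).x = x₀
  init_Δ : (T 0).Δ = q.Δ₀
  init_ε : (T 0).ε = q.ε₀
  init_μ : (T 0).μin = q.μ₀
  valid : ∀ k, (T k).Valid p q
  next : ∀ k, (T k).Next p q (T (k + 1))

/-- The random models. Here `T ω` is the sequence of iterations for the outcome `ω`, the
σ-algebra `ℱ k` contains the randomness before iteration `k`, and `𝒢 k` contains in addition the
gradient and Hessian estimates of iteration `k`. -/
structure IsRandomModel {d m : ℕ} (p : Problem d m) (q : Params) {Ω : Type*} [mΩ : MeasurableSpace Ω]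
    (P : Measure Ω) (ℱ 𝒢 : ℕ → MeasurableSpace Ω) (T : Ω → ℕ → Iteration d m) : Prop where
  le_half : ∀ k, ℱ k ≤ 𝒢 k
  half_le : ∀ k, 𝒢 k ≤ ℱ (k + 1)
  le_total : ∀ k, ℱ k ≤ mΩ
  meas_x : ∀ k, Measurable[ℱ k] fun ω => (T ω k).x
  meas_Δ : ∀ k, Measurable[ℱ k] fun ω => (T ω k).Δ
  meas_ε : ∀ k, Measurable[ℱ k] fun ω => (T ω k).ε
  meas_g : ∀ k, Measurable[𝒢 k] fun ω => (T ω k).g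
  meas_hessF : ∀ k, Measurable[𝒢 k] fun ω => (T ω k).hessF
  meas_H : ∀ k, Measurable[𝒢 k] fun ω => (T ω k).H
  meas_step : ∀ k, Measurable[𝒢 k] fun ω => (T ω k).step p q
  meas_μ : ∀ k, Measurable[𝒢 k] fun ω => (T ω k).μ
  meas_fx : ∀ k, Measurable[ℱ (k + 1)] fun ω => (T ω k).fx
  meas_fs : ∀ k, Measurable[ℱ (k + 1)] fun ω => (T ω k).fs
  meas_fsoc : ∀ k, Measurable[ℱ (k + 1)] fun ω => (T ω k).fsoc
  hess_prob : q.α = 1 → ∀ k, ∀ᵐ ω ∂P,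
    1 - q.ph ≤ (P⟦{ω | (T ω k).HessAccurate p q} | ℱ k⟧) ω
  grad_prob : ∀ k, ∀ᵐ ω ∂P, 1 - q.pg ≤ (P⟦{ω | (T ω k).GradAccurate p q} | ℱ k⟧) ω
  value_prob : ∀ k, ∀ᵐ ω ∂P, 1 - q.pf ≤ (P⟦{ω | (T ω k).ValueAccurate p q} | 𝒢 k⟧) ω
  soc_prob : ∀ k, ∀ᵐ ω ∂P, 1 - q.pf ≤ (P⟦{ω | (T ω k).SocValueAccurate p q} | 𝒢 k⟧) ω
  int_errX : ∀ k, Integrable (fun ω => (T ω k).errX p q ^ 2) P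
  int_errTrial : ∀ k, Integrable (fun ω => (T ω k).errTrial p q ^ 2) P
  int_errFinal : ∀ k, Integrable (fun ω => (T ω k).errFinal p q ^ 2) P
  var_errX : ∀ k, ∀ᵐ ω ∂P, (P[fun ω => (T ω k).errX p q ^ 2 | 𝒢 k]) ω ≤ (T ω k).ε ^ 2
  var_errTrial : ∀ k, ∀ᵐ ω ∂P, (P[fun ω => (T ω k).errTrial p q ^ 2 | 𝒢 k]) ω ≤ (T ω k).ε ^ 2
  var_errFinal : ∀ k, ∀ᵐ ω ∂P, (P[fun ω => (T ω k).errFinal p q ^ 2 | 𝒢 k]) ω ≤ (T ω k).ε ^ 2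

/-- The constants of the assumptions. -/
structure Constants where
  /-- Lipschitz constant of the gradient of `f` -/
  LgradF : ℝ≥0
  /-- Lipschitz constant of the Hessian of `f` -/
  LhessF : ℝ≥0
  /-- Lipschitz constant of the Jacobian of `c` -/
  LG : ℝ≥0
  /-- Lipschitz constant of the Hessians of the components of `c` -/
  LhessC : ℝ≥0
  fInf : ℝ
  κc : ℝ
  κgradF : ℝ
  κ1G : ℝ
  κ2G : ℝ
  /-- bound on the Hessian approximations if `α = 0` -/
  κB : ℝ
  /-- bound on the stabilized merit parameter -/
  μhat : ℝ

/-- Regularity of the problem functions over the open convex set `O`. -/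
structure Regularity {d m : ℕ} (p : Problem d m) (K : Constants) (O : Set (Vec d)) : Prop where
  isOpen : IsOpen O
  convex : Convex ℝ O
  f_contDiff : ContDiffOn ℝ 2 p.f O
  c_contDiff : ContDiffOn ℝ 2 p.c O
  f_bddBelow : ∀ x ∈ O, K.fInf ≤ p.f x
  gradF_lipschitz : LipschitzOnWith K.LgradF (gradient p.f) O
  hessF_lipschitz : LipschitzOnWith K.LhessF (hessian p.f) O
  jac_lipschitz : LipschitzOnWith K.LG p.jac O
  hessC_lipschitz : ∀ i : Fin m, LipschitzOnWith K.LhessC (hessian fun y => p.c y i) O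
  κc_pos : 0 < K.κc
  κgradF_pos : 0 < K.κgradF
  κ1G_pos : 0 < K.κ1G
  κ2G_pos : 0 < K.κ2G
  one_le_κB : 1 ≤ K.κB

/-- The bounds along the sequence of iterates. The order on `Vec m →L[ℝ] Vec m` is the Loewner
order. -/
structure IterateBounds {d m : ℕ} (p : Problem d m) (q : Params) (K : Constants)
    (O : Set (Vec d)) (T : ℕ → Iteration d m) : Prop where
  x_mem : ∀ k, (T k).x ∈ O
  trial_mem : ∀ k, (T k).Accepts p q → (T k).trial p q ∈ O
  xs_mem : ∀ k, (T k).Accepts p q → (T k).xs p q ∈ O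
  c_le : ∀ k, ‖p.c (T k).x‖ ≤ K.κc
  grad_le : ∀ k, ‖gradient p.f (T k).x‖ ≤ K.κgradF
  gram_ge : ∀ k, K.κ1G • ContinuousLinearMap.id ℝ (Vec m) ≤
    (p.jac (T k).x).comp (p.jac (T k).x).adjoint
  gram_le : ∀ k, (p.jac (T k).x).comp (p.jac (T k).x).adjoint ≤
    K.κ2G • ContinuousLinearMap.id ℝ (Vec m)
  H_le : q.α = 0 → ∀ k, ‖(T k).H‖ ≤ K.κB

/-- The merit parameter stabilizes at a value not above `μhat`. -/
def MeritStabilizes {d m : ℕ} (K : Constants) (T : ℕ → Iteration d m) : Prop :=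
  ∃ Kbar : ℕ, ∀ k, Kbar ≤ k → (T k).μ = (T Kbar).μ ∧ (T Kbar).μ ≤ K.μhat

/-- The constant `κ_B`: the assumed bound on the Hessian approximations if `α = 0`, and the
bound that is implied by accurate estimates if `α = 1`. -/
def kappaB (m : ℕ) (q : Params) (K : Constants) : ℝ :=
  if q.α = 0 then K.κB
  else max 1 (q.κh * q.Δmax + K.LgradF +
    √m * K.LG / √K.κ1G * (q.κg * q.Δmax ^ 2 + K.κgradF))

def Upsilon1 (m : ℕ) (q : Params) (K : Constants) : ℝ :=
  q.κg * max 1 q.Δmax + 1 / 2 * (K.LgradF + kappaB m q K + K.μhat * K.LG)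

def Upsilon3 (m : ℕ) (q : Params) (K : Constants) : ℝ :=
  3 * q.κfcd / 8 *
    max (kappaB m q K / (q.κg * max 1 q.Δmax + kappaB m q K))
      ((4 * q.κf * max 1 q.Δmax + 8 * Upsilon1 m q K) /
        (((1 - q.η) * q.κfcd * q.κg + 4 * q.κf) * max 1 q.Δmax + 8 * Upsilon1 m q K))

/-- The condition on the weight `ν` of the potential function. -/
def WeightCond (m : ℕ) (q : Params) (K : Constants) (ν : ℝ) : Prop :=
  ν ∈ Set.Ioo (0 : ℝ) 1 ∧
  max (4 * q.γ ^ 3 * max 1 q.Δmax / min (q.η ^ 3 * q.κfcd) (Upsilon3 m q K)) (2 * q.γ / q.η) ≤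
    ν / (1 - ν)

end TRSQP

end

/-! The proof is a drift argument for the function `potential`: a weighted sum of the merit
function, the power Δ^(α+2) of the radius and the reliability parameter ε. An unsuccessful iteration
shrinks Δ and ε by the factor γ, which lowers the potential. A successful one may enlarge both, but
then the predicted reduction is at least a multiple of Δ^(α+2), and ε grows only if it is below that
reduction. The condition on ν lets the decrease of the merit function pay for this. So each
iteration gains `decayRate` times Δ^(α+2) + ε, up to the errors of the value estimates. Accurate
values cost nothing extra (`potential_le_of_accurate`). Inaccurate ones have conditional probability
at most 2 p_f, and Young's inequality bounds their expected cost by a multiple √(2 p_f) of the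
expectation of ε (`integral_error_indicator_le`), which the decay of ε covers. Telescoping gives
`summable_integral_gain`.

Three consequences are used. First, Δ^(α+2) is summable, so Δ tends to 0 (`ae_tendsto_radius`).
Second, if the residual is at least a fixed threshold and Δ is small, an accurate iteration succeeds
with predicted reduction of order Δ itself (`exists_radius_successful`). Hence Δ is summable over
the accurate iterations with large residual, and, since accuracy is likely given the past, over all
iterations with large residual (`ae_summable_largeRadius`). Third, the residual cannot stay large:
otherwise 1/Δ would contract in expectation although it is bounded below by 1/Δmax
(`ae_exists_small`).

The residual is Lipschitz along the iterates and a step has length of order Δ. From a late index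
with small residual, all later excursions are controlled by a tail of a convergent series, so the
lower limit 0 is a limit (`tendsto_zero_of_summable_on_large`).

The index at which the merit parameter stabilizes is random and not known from the past. All
estimates are therefore made on the decreasing adapted events `stableEvent`, for each deterministic
starting index separately. -/

noncomputable section

namespace TRSQP

/-! ### Elementary facts on norms -/

section Norms

variable {E F : Type*} [NormedAddCommGroup E] [NormedAddCommGroup F]

lemma pairNorm_eq (a : E) (b : F) : pairNorm a b = √(‖a‖ ^ 2 + ‖b‖ ^ 2) := by
  simp [pairNorm, WithLp.prod_norm_eq_of_L2]

lemma pairNorm_nonneg (a : E) (b : F) : 0 ≤ pairNorm a b := norm_nonneg _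

lemma norm_le_pairNorm_left (a : E) (b : F) : ‖a‖ ≤ pairNorm a b := by
  rw [pairNorm_eq]
  exact Real.le_sqrt_of_sq_le (by nlinarith [sq_nonneg ‖b‖])

lemma norm_le_pairNorm_right (a : E) (b : F) : ‖b‖ ≤ pairNorm a b := by
  rw [pairNorm_eq]
  exact Real.le_sqrt_of_sq_le (by nlinarith [sq_nonneg ‖a‖])

lemma abs_pairNorm_sub_le (a a' : E) (b b' : F) :
    |pairNorm a b - pairNorm a' b'| ≤ ‖a - a'‖ + ‖b - b'‖ := by
  have h1 : |pairNorm a b - pairNorm a' b'| ≤ pairNorm (a - a') (b - b') :=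
    abs_norm_sub_norm_le (WithLp.toLp 2 (a, b)) (WithLp.toLp 2 (a', b'))
  refine h1.trans ?_
  rw [pairNorm_eq]
  refine (Real.sqrt_le_left (by positivity)).2 ?_
  nlinarith [mul_nonneg (norm_nonneg (a - a')) (norm_nonneg (b - b'))]

lemma minRatio_nonneg {a b c : ℝ} (ha : 0 ≤ a) (hb : 0 ≤ b) (hc : 0 ≤ c) :
    0 ≤ minRatio a b c := by
  unfold minRatio
  split_ifs
  · exact ha
  · exact le_min ha (div_nonneg hb hc)

lemma le_minRatio {a b c t : ℝ} (hc : 0 ≤ c) (ha : t ≤ a) (hb : t * c ≤ b) :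
    t ≤ minRatio a b c := by
  unfold minRatio
  split_ifs with h
  · exact ha
  · exact le_min ha ((le_div_iff₀ (lt_of_le_of_ne hc (Ne.symm h))).2 hb)

lemma norm_minRatio_smul_le [NormedSpace ℝ E] {R : ℝ} (hR : 0 ≤ R) (v : E) :
    ‖minRatio 1 R ‖v‖ • v‖ ≤ R := by
  rw [norm_smul, Real.norm_of_nonneg (minRatio_nonneg zero_le_one hR (norm_nonneg _))]
  unfold minRatio
  split_ifs with h
  · simpa [h] using hR
  · have hv : 0 < ‖v‖ := lt_of_le_of_ne (norm_nonneg _) (Ne.symm h)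
    calc min 1 (R / ‖v‖) * ‖v‖ ≤ R / ‖v‖ * ‖v‖ := by gcongr; exact min_le_right _ _
      _ = R := by field_simp

end Norms

/-! ### The problem functions at points with bounded data -/

/-- A point of `O` at which the bounds on the problem functions hold. -/
structure BoundedAt {d m : ℕ} (p : Problem d m) (K : Constants) (O : Set (Vec d))
    (x : Vec d) : Prop where
  mem : x ∈ O
  c_le : ‖p.c x‖ ≤ K.κc
  grad_le : ‖gradient p.f x‖ ≤ K.κgradF
  gram_ge : K.κ1G • ContinuousLinearMap.id ℝ (Vec m) ≤ (p.jac x).comp (p.jac x).adjoint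
  gram_le : (p.jac x).comp (p.jac x).adjoint ≤ K.κ2G • ContinuousLinearMap.id ℝ (Vec m)

section BoundedPoints

variable {d m : ℕ} {p : Problem d m} {K : Constants} {O : Set (Vec d)}

/-- Cauchy–Schwarz turns the lower Loewner bound into a lower bound on the norm. It yields both
invertibility and the bound on the inverse. -/
lemma BoundedAt.le_norm_gram {x : Vec d} (hx : BoundedAt p K O x) (y : Vec m) :
    K.κ1G * ‖y‖ ≤ ‖(p.jac x).comp (p.jac x).adjoint y‖ := by
  have h := (ContinuousLinearMap.le_def _ _).1 hx.gram_ge |>.inner_nonneg_right y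
  simp only [sub_apply, smul_apply,
    ContinuousLinearMap.id_apply, inner_sub_right, inner_smul_right, real_inner_self_eq_norm_sq]
    at h
  have h2 := real_inner_le_norm y ((p.jac x).comp (p.jac x).adjoint y)
  rcases eq_or_lt_of_le (norm_nonneg y) with h0 | h0
  · rw [← h0]; simp
  · nlinarith

lemma BoundedAt.norm_jac_le {x : Vec d} (hx : BoundedAt p K O x) : ‖p.jac x‖ ≤ √K.κ2G := by
  rw [← LinearIsometryEquiv.norm_map ContinuousLinearMap.adjoint (p.jac x)]
  refine ContinuousLinearMap.opNorm_le_bound _ (Real.sqrt_nonneg _) fun y => ?_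
  have h := (ContinuousLinearMap.le_def _ _).1 hx.gram_le |>.inner_nonneg_right y
  simp only [sub_apply, smul_apply,
    ContinuousLinearMap.id_apply, inner_sub_right, inner_smul_right, real_inner_self_eq_norm_sq,
    ContinuousLinearMap.comp_apply] at h
  -- The quadratic form of the Gram matrix at `y` is the squared norm of the transposed Jacobian
  -- applied to `y`.
  rw [← ContinuousLinearMap.adjoint_inner_left, real_inner_self_eq_norm_sq] at h
  refine abs_le_of_sq_le_sq' ?_ (by positivity) |>.2
  rcases le_total 0 K.κ2G with hK | hK
  · rw [mul_pow, Real.sq_sqrt hK]; linarith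
  · have : K.κ2G * ‖y‖ ^ 2 ≤ 0 := mul_nonpos_of_nonpos_of_nonneg hK (sq_nonneg _)
    nlinarith [sq_nonneg (√K.κ2G * ‖y‖)]

/-- An injective endomorphism of a finite-dimensional space is bijective. Without this,
`ContinuousLinearMap.inverse` could be its default value 0. -/
lemma BoundedAt.gram_isInvertible (hreg : Regularity p K O) {x : Vec d}
    (hx : BoundedAt p K O x) : ((p.jac x).comp (p.jac x).adjoint).IsInvertible := by
  set A := (p.jac x).comp (p.jac x).adjoint with hA
  have hinj : Function.Injective (A : Vec m →ₗ[ℝ] Vec m) := by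
    refine (injective_iff_map_eq_zero _).2 fun y hy => ?_
    have h := hx.le_norm_gram y
    rw [← hA, show A y = 0 from hy, norm_zero] at h
    exact norm_le_zero_iff.1 (nonpos_of_mul_nonpos_right h hreg.κ1G_pos)
  exact ⟨(LinearEquiv.ofInjectiveEndo (A : Vec m →ₗ[ℝ] Vec m) hinj).toContinuousLinearEquiv,
    by ext y; simp [LinearEquiv.coe_ofInjectiveEndo]⟩

lemma BoundedAt.norm_gramInv_le (hreg : Regularity p K O) {x : Vec d}
    (hx : BoundedAt p K O x) : ‖p.gramInv x‖ ≤ K.κ1G⁻¹ := by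
  refine ContinuousLinearMap.opNorm_le_bound _ (inv_nonneg.2 hreg.κ1G_pos.le) fun y => ?_
  have h := hx.le_norm_gram (p.gramInv x y)
  rw [Problem.gramInv, (hx.gram_isInvertible hreg).self_apply_inverse] at h
  rw [inv_mul_eq_div, le_div_iff₀ hreg.κ1G_pos, mul_comm]
  exact h

lemma lagGrad_eq_proj (x g : Vec d) : p.lagGrad x g = p.proj x g := by
  simp [Problem.lagGrad, Problem.proj, Problem.multiplier, sub_eq_add_neg]

/-- A bound on the norm of the projection. -/
def projBound (K : Constants) : ℝ := 1 + √K.κ2G * (K.κ1G⁻¹ * √K.κ2G)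

lemma projBound_pos (hreg : Regularity p K O) : 0 < projBound K := by
  have := hreg.κ1G_pos
  unfold projBound; positivity

lemma BoundedAt.norm_proj_le (hreg : Regularity p K O) {x : Vec d}
    (hx : BoundedAt p K O x) : ‖p.proj x‖ ≤ projBound K := by
  have h1 := hx.norm_jac_le
  have h2 := hx.norm_gramInv_le hreg
  have h3 := hreg.κ1G_pos
  refine (norm_sub_le _ _).trans (add_le_add ContinuousLinearMap.norm_id_le ?_)
  refine (ContinuousLinearMap.opNorm_comp_le _ _).trans ?_
  rw [LinearIsometryEquiv.norm_map]
  gcongr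
  exact (ContinuousLinearMap.opNorm_comp_le _ _).trans (by gcongr)

/-- The feasibility components cancel and the optimality component is linear in the gradient, so
only the norm of the projection enters. -/
lemma BoundedAt.abs_kktNorm_sub_le (hreg : Regularity p K O) {x : Vec d}
    (hx : BoundedAt p K O x) (g g' : Vec d) :
    |p.kktNorm x g - p.kktNorm x g'| ≤ projBound K * ‖g - g'‖ := by
  refine (abs_pairNorm_sub_le _ _ _ _).trans ?_
  rw [sub_self, norm_zero, add_zero, lagGrad_eq_proj, lagGrad_eq_proj, ← map_sub]
  exact ((p.proj x).le_opNorm _).trans (by gcongr; exact hx.norm_proj_le hreg)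

/-! ### Taylor remainders and Hessian bounds -/

lemma Regularity.norm_sub_taylor_c_le (hreg : Regularity p K O) {x y : Vec d} (hx : x ∈ O)
    (hy : y ∈ O) : ‖p.c y - p.c x - p.jac x (y - x)‖ ≤ K.LG * ‖y - x‖ ^ 2 := by
  have hseg : segment ℝ x y ⊆ O := hreg.convex.segment_subset hx hy
  -- Mean value inequality on the segment, where the Jacobian differs from that at `x` by at most
  -- `K.LG * ‖y - x‖`. The factor 1/2 is lost, which is harmless.
  have h := (convex_segment x y).norm_image_sub_le_of_norm_fderiv_le' (𝕜 := ℝ) (f := p.c)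
    (φ := p.jac x) (C := K.LG * ‖y - x‖) (x := x) (y := y)
    (fun z hz => (hreg.c_contDiff.contDiffAt (hreg.isOpen.mem_nhds (hseg hz))).differentiableAt
      (by norm_num)) (fun z hz => ?_) (left_mem_segment ℝ x y) (right_mem_segment ℝ x y)
  · refine h.trans (le_of_eq (by ring))
  · have h1 := hreg.jac_lipschitz.norm_sub_le (hseg hz) hx
    have h2 := norm_sub_le_of_mem_segment hz
    exact h1.trans (by gcongr)

lemma Regularity.abs_sub_taylor_f_le (hreg : Regularity p K O) {x y : Vec d} (hx : x ∈ O)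
    (hy : y ∈ O) : |p.f y - p.f x - ⟪gradient p.f x, y - x⟫_ℝ| ≤ K.LgradF * ‖y - x‖ ^ 2 := by
  have hseg : segment ℝ x y ⊆ O := hreg.convex.segment_subset hx hy
  have h := (convex_segment x y).norm_image_sub_le_of_norm_fderiv_le' (𝕜 := ℝ) (f := p.f)
    (φ := fderiv ℝ p.f x) (C := K.LgradF * ‖y - x‖) (x := x) (y := y)
    (fun z hz => (hreg.f_contDiff.contDiffAt (hreg.isOpen.mem_nhds (hseg hz))).differentiableAt
      (by norm_num)) (fun z hz => ?_) (left_mem_segment ℝ x y) (right_mem_segment ℝ x y)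
  · rw [inner_gradient_left]
    exact h.trans (le_of_eq (by ring))
  · have h1 := hreg.gradF_lipschitz.norm_sub_le (hseg hz) hx
    have h2 := norm_sub_le_of_mem_segment hz
    rw [gradient, gradient, ← map_sub, LinearIsometryEquiv.norm_map] at h1
    exact h1.trans (by gcongr)

lemma Regularity.norm_hessian_f_le (hreg : Regularity p K O) {x : Vec d} (hx : x ∈ O) :
    ‖hessian p.f x‖ ≤ K.LgradF :=
  norm_fderiv_le_of_lipschitzOn ℝ (hreg.isOpen.mem_nhds hx) hreg.gradF_lipschitz

/-- A coordinate of a vector is bounded by its norm, so each component gradient inherits the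
Lipschitz constant of the Jacobian. -/
lemma Regularity.norm_hessian_c_le (hreg : Regularity p K O) {x : Vec d} (hx : x ∈ O)
    (i : Fin m) : ‖hessian (fun y => p.c y i) x‖ ≤ K.LG := by
  refine norm_fderiv_le_of_lipschitzOn ℝ (hreg.isOpen.mem_nhds hx)
    (LipschitzOnWith.of_dist_le_mul fun y hy z hz => ?_)
  have hd : ∀ w ∈ O, fderiv ℝ (fun y => p.c y i) w =
      (EuclideanSpace.proj (𝕜 := ℝ) i).comp (p.jac w) := fun w hw =>
    ((EuclideanSpace.proj (𝕜 := ℝ) i).hasFDerivAt.comp w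
      ((hreg.c_contDiff.contDiffAt (hreg.isOpen.mem_nhds hw)).differentiableAt
        (by norm_num)).hasFDerivAt).fderiv
  rw [dist_eq_norm, dist_eq_norm, gradient, gradient, ← map_sub, LinearIsometryEquiv.norm_map,
    hd y hy, hd z hz, ← ContinuousLinearMap.comp_sub]
  refine le_trans ?_ (hreg.jac_lipschitz.norm_sub_le hy hz)
  refine ContinuousLinearMap.opNorm_le_bound _ (norm_nonneg _) fun w => ?_
  exact (PiLp.norm_apply_le (p := 2) ((p.jac y - p.jac z) w) i).trans
    ((p.jac y - p.jac z).le_opNorm w)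

/-! ### Lipschitz continuity of the projection and of the KKT residual -/

lemma norm_comp_sub_comp_le {E F G : Type*} [NormedAddCommGroup E] [NormedSpace ℝ E]
    [NormedAddCommGroup F] [NormedSpace ℝ F] [NormedAddCommGroup G] [NormedSpace ℝ G]
    (A A' : F →L[ℝ] G) (B B' : E →L[ℝ] F) :
    ‖A.comp B - A'.comp B'‖ ≤ ‖A - A'‖ * ‖B‖ + ‖A'‖ * ‖B - B'‖ := by
  have h : A.comp B - A'.comp B' = (A - A').comp B + A'.comp (B - B') := by
    ext v; simp
  rw [h]
  exact (norm_add_le _ _).trans (add_le_add (ContinuousLinearMap.opNorm_comp_le _ _)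
    (ContinuousLinearMap.opNorm_comp_le _ _))

/-- The projection is Lipschitz continuous along points with bounded data. -/
lemma BoundedAt.norm_proj_sub_le (hreg : Regularity p K O) {x y : Vec d}
    (hx : BoundedAt p K O x) (hy : BoundedAt p K O y) :
    ‖p.proj x - p.proj y‖ ≤ (2 * (K.LG * (K.κ1G⁻¹ * √K.κ2G)) +
      √K.κ2G * (K.κ1G⁻¹ * (2 * (√K.κ2G * K.LG)) * K.κ1G⁻¹) * √K.κ2G) * ‖x - y‖ := by
  have hκ := hreg.κ1G_pos
  have hxG := hx.norm_jac_le
  have hyG := hy.norm_jac_le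
  have hxI := hx.norm_gramInv_le hreg
  have hyI := hy.norm_gramInv_le hreg
  have hG := hreg.jac_lipschitz.norm_sub_le hx.mem hy.mem
  have hGt : ‖(p.jac x).adjoint - (p.jac y).adjoint‖ ≤ K.LG * ‖x - y‖ := by
    rw [← map_sub, LinearIsometryEquiv.norm_map]; exact hG
  have hxG' : ‖(p.jac x).adjoint‖ ≤ √K.κ2G := by rwa [LinearIsometryEquiv.norm_map]
  have hyG' : ‖(p.jac y).adjoint‖ ≤ √K.κ2G := by rwa [LinearIsometryEquiv.norm_map]
  set a := √K.κ2G with ha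
  set t := ‖x - y‖ with ht
  have hA : ‖(p.jac y).comp (p.jac y).adjoint - (p.jac x).comp (p.jac x).adjoint‖
      ≤ 2 * (a * (K.LG * t)) := by
    rw [norm_sub_rev]
    refine (norm_comp_sub_comp_le _ _ _ _).trans ?_
    calc _ ≤ (K.LG * t) * a + a * (K.LG * t) := by gcongr
      _ = _ := by ring
  have hI : ‖p.gramInv x - p.gramInv y‖ ≤ K.κ1G⁻¹ * (2 * (a * (K.LG * t))) * K.κ1G⁻¹ := by
    -- Resolvent identity A⁻¹ - B⁻¹ = A⁻¹ (B - A) B⁻¹.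
    have h : p.gramInv x - p.gramInv y = (p.gramInv x).comp
        (((p.jac y).comp (p.jac y).adjoint - (p.jac x).comp (p.jac x).adjoint).comp
          (p.gramInv y)) := by
      ext1 v
      have h1 := (hy.gram_isInvertible hreg).self_apply_inverse v
      have h2 := (hx.gram_isInvertible hreg).inverse_apply_self (p.gramInv y v)
      simp only [ContinuousLinearMap.comp_apply, sub_apply, map_sub] at h1 h2 ⊢
      rw [Problem.gramInv, Problem.gramInv] at *
      rw [h1, h2]
    rw [h]
    refine (ContinuousLinearMap.opNorm_comp_le _ _).trans ?_
    rw [mul_assoc]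
    gcongr
    exact (ContinuousLinearMap.opNorm_comp_le _ _).trans (by gcongr)
  have h1 : ‖(p.gramInv x).comp (p.jac x) - (p.gramInv y).comp (p.jac y)‖ ≤
      K.κ1G⁻¹ * (2 * (a * (K.LG * t))) * K.κ1G⁻¹ * a + K.κ1G⁻¹ * (K.LG * t) :=
    (norm_comp_sub_comp_le _ _ _ _).trans (by gcongr)
  have h2 : ‖(p.gramInv x).comp (p.jac x)‖ ≤ K.κ1G⁻¹ * a :=
    (ContinuousLinearMap.opNorm_comp_le _ _).trans (by gcongr)
  rw [Problem.proj, Problem.proj, sub_sub_sub_cancel_left, norm_sub_rev]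
  refine (norm_comp_sub_comp_le _ _ _ _).trans ?_
  calc _ ≤ (K.LG * t) * (K.κ1G⁻¹ * a) +
        a * (K.κ1G⁻¹ * (2 * (a * (K.LG * t))) * K.κ1G⁻¹ * a + K.κ1G⁻¹ * (K.LG * t)) := by gcongr
    _ = _ := by ring

/-- The Jacobian is bounded only at the two points, not along the segment between them. Nearby
points are compared by Taylor expansion at `y`, where the quadratic term is dominated by a linear
one; for points at distance at least 1 the bound on the constraint values suffices. -/
lemma BoundedAt.norm_c_sub_le (hreg : Regularity p K O) {x y : Vec d}
    (hx : BoundedAt p K O x) (hy : BoundedAt p K O y) :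
    ‖p.c x - p.c y‖ ≤ (√K.κ2G + K.LG + 2 * K.κc) * ‖x - y‖ := by
  have hκ := hreg.κc_pos
  have h0 := Real.sqrt_nonneg K.κ2G
  have hL := K.LG.coe_nonneg
  have ht := norm_nonneg (x - y)
  rcases le_total ‖x - y‖ 1 with h | h
  · have h1 := hreg.norm_sub_taylor_c_le hy.mem hx.mem
    have h2 : ‖p.jac y (x - y)‖ ≤ √K.κ2G * ‖x - y‖ :=
      ((p.jac y).le_opNorm _).trans (by gcongr; exact hy.norm_jac_le)
    have h3 := norm_add_le (p.c x - p.c y - p.jac y (x - y)) (p.jac y (x - y))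
    rw [sub_add_cancel] at h3
    have h4 : K.LG * ‖x - y‖ ^ 2 ≤ K.LG * ‖x - y‖ := by
      gcongr
      nlinarith
    nlinarith
  · have h1 := (norm_sub_le (p.c x) (p.c y)).trans (add_le_add hx.c_le hy.c_le)
    nlinarith [mul_nonneg h0 ht, mul_nonneg hL ht]

/-- The KKT residual is Lipschitz continuous along points with bounded data. -/
lemma exists_lipschitzOnWith_kktResidual (hreg : Regularity p K O) :
    ∃ C : ℝ≥0, LipschitzOnWith C p.kktResidual {x | BoundedAt p K O x} := by
  have hκ := hreg.κ1G_pos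
  have hκg := hreg.κgradF_pos
  have hκc := hreg.κc_pos
  have hP := (projBound_pos hreg).le
  refine ⟨_, LipschitzOnWith.of_dist_le' (K := (2 * (K.LG * (K.κ1G⁻¹ * √K.κ2G)) +
      √K.κ2G * (K.κ1G⁻¹ * (2 * (√K.κ2G * K.LG)) * K.κ1G⁻¹) * √K.κ2G) * K.κgradF +
      projBound K * K.LgradF + (√K.κ2G + K.LG + 2 * K.κc)) fun x hx y hy => ?_⟩
  have h1 := BoundedAt.norm_proj_sub_le hreg hx hy
  have h2 := BoundedAt.norm_c_sub_le hreg hx hy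
  have h3 := BoundedAt.norm_proj_le hreg hy
  have h4 := hreg.gradF_lipschitz.norm_sub_le hx.mem hy.mem
  rw [Real.dist_eq, dist_eq_norm]
  refine (abs_pairNorm_sub_le _ _ _ _).trans ?_
  rw [lagGrad_eq_proj, lagGrad_eq_proj]
  -- Product rule: the bounded gradient multiplies the increment of the projection, and the bounded
  -- projection acts on the increment of the gradient.
  have h5 : p.proj x (gradient p.f x) - p.proj y (gradient p.f y) =
      (p.proj x - p.proj y) (gradient p.f x) +
        p.proj y (gradient p.f x - gradient p.f y) := by simp
  rw [h5]
  refine (add_le_add (norm_add_le _ _) h2).trans ?_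
  have h6 := ((p.proj x - p.proj y).le_opNorm (gradient p.f x)).trans
    (mul_le_mul h1 hx.grad_le (norm_nonneg _) (by positivity))
  have h7 := ((p.proj y).le_opNorm (gradient p.f x - gradient p.f y)).trans
    (mul_le_mul h3 h4 (norm_nonneg _) hP)
  refine (add_le_add_left (add_le_add h6 h7) _).trans (le_of_eq ?_)
  ring

end BoundedPoints

/-! ### A single iteration -/

section SingleIteration

variable {d m : ℕ} {p : Problem d m} {q : Params} {K : Constants} {O : Set (Vec d)}
  {it : Iteration d m}

namespace Iteration

lemma kktEst_nonneg : 0 ≤ it.kktEst p := pairNorm_nonneg _ _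

lemma τplus_nonneg : 0 ≤ it.τplus q := by
  unfold τplus; split_ifs
  · exact abs_nonneg _
  · exact le_rfl

lemma normalRadius_mem (hΔ : 0 ≤ it.Δ) : it.normalRadius p q ∈ Set.Icc 0 it.Δ := by
  unfold normalRadius
  split_ifs
  · exact ⟨le_rfl, hΔ⟩
  · exact ⟨mul_nonneg (div_nonneg (norm_nonneg _) (pairNorm_nonneg _ _)) hΔ,
      mul_le_of_le_one_left hΔ
        (div_le_one_of_le₀ (norm_le_pairNorm_right _ _) (pairNorm_nonneg _ _))⟩
  · exact ⟨mul_nonneg (div_nonneg (norm_nonneg _) (pairNorm_nonneg _ _)) hΔ,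
      mul_le_of_le_one_left hΔ
        (div_le_one_of_le₀ (norm_le_pairNorm_left _ _) (pairNorm_nonneg _ _))⟩

lemma tangentialRadius_le (hΔ : 0 ≤ it.Δ) : it.tangentialRadius p q ≤ it.Δ := by
  unfold tangentialRadius
  split_ifs
  · exact le_rfl
  · exact mul_le_of_le_one_left hΔ
      (div_le_one_of_le₀ (norm_le_pairNorm_left _ _) (pairNorm_nonneg _ _))
  · exact mul_le_of_le_one_left hΔ
      (div_le_one_of_le₀ ((Real.le_norm_self _).trans (norm_le_pairNorm_right _ _))
        (pairNorm_nonneg _ _))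

lemma Valid.norm_Z_apply (hv : it.Valid p q) (u : Vec (d - m)) : ‖it.Z u‖ = ‖u‖ := by
  have h : ‖it.Z u‖ ^ 2 = ‖u‖ ^ 2 := by
    rw [← real_inner_self_eq_norm_sq, ← ContinuousLinearMap.adjoint_inner_left,
      ← ContinuousLinearMap.comp_apply, hv.Z_orthonormal, ContinuousLinearMap.id_apply,
      real_inner_self_eq_norm_sq]
  exact (sq_eq_sq₀ (norm_nonneg _) (norm_nonneg _)).1 h

/-- Each of the normal and tangential parts is at most Δ. The triangle inequality is enough;
orthogonality of the parts and the precise split of the radius play no role. -/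
lemma Valid.norm_step_le (hv : it.Valid p q) (hΔ : 0 ≤ it.Δ) (hacc : it.Accepts p q) :
    ‖it.step p q‖ ≤ 2 * it.Δ := by
  have hn := normalRadius_mem (p := p) (q := q) hΔ
  have h1 : ‖it.normalStep p q‖ ≤ it.Δ := (norm_minRatio_smul_le hn.1 _).trans hn.2
  have h2 : ‖it.u‖ ≤ it.tangentialRadius p q := by
    by_cases hg : it.IsGradStep p q
    · exact (hv.gradStep hacc hg).1
    · exact (hv.eigenStep hacc hg).2.1
  have h3 : ‖it.Z it.u‖ ≤ it.Δ := by
    rw [hv.norm_Z_apply]; exact h2.trans (tangentialRadius_le hΔ)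
  exact (norm_add_le _ _).trans (by linarith)

/-! ### Size of the predicted reduction -/

lemma Valid.pred_le (hv : it.Valid p q) (hacc : it.Accepts p q) :
    it.pred p q ≤ it.predBound p q := by
  obtain ⟨j, hj, hμ⟩ := hv.merit hacc
  have := hj.1
  rwa [Set.mem_ofPred_eq, ← hμ] at this

lemma Valid.gradReduction_le (hq : q.Valid) (hv : it.Valid p q) (hacc : it.Accepts p q) :
    q.κfcd * it.gradReduction p ≤ 2 * -it.pred p q := by
  have h := hv.pred_le hacc
  have h1 := le_max_left (it.gradReduction p) (it.eigenReduction p q)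
  have h2 := hq.κfcd_mem.1
  unfold predBound at h
  nlinarith

lemma Valid.eigenReduction_le (hq : q.Valid) (hv : it.Valid p q) (hacc : it.Accepts p q) :
    q.κfcd * it.eigenReduction p q ≤ 2 * -it.pred p q := by
  have h := hv.pred_le hacc
  have h1 := le_max_right (it.gradReduction p) (it.eigenReduction p q)
  have h2 := hq.κfcd_mem.1
  unfold predBound at h
  nlinarith

/-- Raising the radius to the exponent `α + n` costs at most a factor `max {1, Δmax}`. -/
lemma _root_.TRSQP.pow_alpha_add_le (q : Params) {Δ : ℝ} (n : ℕ) (hΔ : 0 ≤ Δ)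
    (hle : Δ ≤ q.Δmax) : Δ ^ ((q.α : ℕ) + n) ≤ max 1 q.Δmax * Δ ^ n := by
  rw [pow_add]
  gcongr
  rcases (by lia : (q.α : ℕ) = 0 ∨ (q.α : ℕ) = 1) with h | h
  · rw [h, pow_zero]; exact le_max_left _ _
  · rw [h, pow_one]; exact hle.trans (le_max_right _ _)

/-- The test of Step 2 is passed by one of two quantities. If the scaled residual passes, the
gradient reduction is at least (ηΔ)². If the curvature passes, then α = 1 and the eigen reduction is
at least ηΔ³. Either way a step that is computed promises a decrease of order Δ^(α+2), which pays
for enlarging the radius. -/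
lemma Valid.pow_radius_le_neg_pred (hq : q.Valid) (hv : it.Valid p q) (hΔ : 0 < it.Δ)
    (hle : it.Δ ≤ q.Δmax) (hacc : it.Accepts p q) :
    q.κfcd * q.η ^ 2 * it.Δ ^ ((q.α : ℕ) + 2) ≤ 2 * max 1 q.Δmax * -it.pred p q := by
  have hη := hq.η_mem
  have hκ := hq.κfcd_mem.1
  have hM : 1 ≤ max 1 q.Δmax := le_max_left _ _
  rcases le_max_iff.1 hacc with h | h
  · rw [le_div_iff₀ (by positivity)] at h
    have h1 : q.η * it.Δ ≤ minRatio it.Δ (it.kktEst p) ‖it.H‖ := by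
      refine le_minRatio (norm_nonneg _) (by nlinarith [hη.2]) (le_trans ?_ h)
      have := hη.1
      gcongr
      exact le_max_right _ _
    have h2 : q.η * it.Δ ≤ it.kktEst p := by
      refine le_trans (le_mul_of_one_le_right ?_ (le_max_left _ _)) h
      have := hη.1
      positivity
    have h0 : 0 ≤ q.η * it.Δ := by have := hη.1; positivity
    have h3 : (q.η * it.Δ) * (q.η * it.Δ) ≤ it.gradReduction p :=
      mul_le_mul h2 h1 h0 (kktEst_nonneg)
    have h4 := hv.gradReduction_le hq hacc
    have h5 := pow_alpha_add_le q 2 hΔ.le hle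
    calc q.κfcd * q.η ^ 2 * it.Δ ^ ((q.α : ℕ) + 2)
        ≤ q.κfcd * q.η ^ 2 * (max 1 q.Δmax * it.Δ ^ 2) := by gcongr
      _ = max 1 q.Δmax * (q.κfcd * ((q.η * it.Δ) * (q.η * it.Δ))) := by ring
      _ ≤ max 1 q.Δmax * (2 * -it.pred p q) := by
          refine mul_le_mul_of_nonneg_left ?_ (by positivity)
          exact (mul_le_mul_of_nonneg_left h3 hκ.le).trans h4
      _ = _ := by ring
  -- For α = 0 the curvature is 0 by definition and cannot reach the positive number ηΔ.
  · have hα : q.α = 1 := by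
      by_contra hα
      rw [τplus, if_neg hα] at h
      nlinarith [hη.1]
    have h1 : q.η * it.Δ * it.Δ * it.Δ ≤ it.eigenReduction p q := by
      have := hη.1
      have := norm_nonneg (p.c it.x)
      have := τplus_nonneg (it := it) (q := q)
      unfold eigenReduction
      gcongr
      linarith
    have h4 := hv.eigenReduction_le hq hacc
    have hp : 0 ≤ q.η * it.Δ * it.Δ * it.Δ := by have := hη.1; positivity
    have hη2 : q.η ^ 2 ≤ q.η := by nlinarith [hη.1, hη.2]
    rw [hα]
    calc q.κfcd * q.η ^ 2 * it.Δ ^ 3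
        ≤ q.κfcd * q.η * it.Δ ^ 3 := by gcongr
      _ = q.κfcd * (q.η * it.Δ * it.Δ * it.Δ) := by ring
      _ ≤ 1 * (2 * -it.pred p q) := by
          rw [one_mul]
          exact (mul_le_mul_of_nonneg_left h1 hκ.le).trans h4
      _ ≤ max 1 q.Δmax * (2 * -it.pred p q) := by
          gcongr
          exact (mul_nonneg hκ.le hp).trans ((mul_le_mul_of_nonneg_left h1 hκ.le).trans h4)
      _ = _ := by ring

/-- The sign is needed to clear the denominator in the acceptance ratio, which reverses the
inequality. -/
lemma Valid.pred_neg (hq : q.Valid) (hv : it.Valid p q) (hΔ : 0 < it.Δ)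
    (hle : it.Δ ≤ q.Δmax) (hacc : it.Accepts p q) : it.pred p q < 0 := by
  have h := hv.pow_radius_le_neg_pred hq hΔ hle hacc
  have hη := hq.η_mem.1
  have hκ := hq.κfcd_mem.1
  have h0 : 0 < q.κfcd * q.η ^ 2 * it.Δ ^ ((q.α : ℕ) + 2) := by positivity
  have h1 : 0 < 2 * max 1 q.Δmax := by positivity
  linarith [pos_of_mul_pos_right (h0.trans_le h) h1.le]

lemma errX_nonneg : 0 ≤ it.errX p q := by
  unfold errX; split_ifs <;> positivity

lemma errFinal_nonneg : 0 ≤ it.errFinal p q := by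
  unfold errFinal; split_ifs <;> positivity

/-- A successful iteration reduces the merit function by a fraction of the predicted reduction,
up to the errors of the function value estimates. -/
lemma Valid.merit_le_of_successful (hq : q.Valid) (hv : it.Valid p q) (hΔ : 0 < it.Δ)
    (hle : it.Δ ≤ q.Δmax) (hs : it.Successful p q) :
    p.f (it.xs p q) + it.μ * ‖p.c (it.xs p q)‖ ≤
      p.f it.x + it.μ * ‖p.c it.x‖ + q.η * it.pred p q + (it.errX p q + it.errFinal p q) := by
  have h := hs.2
  rw [le_div_iff_of_neg (hv.pred_neg hq hΔ hle hs.1)] at h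
  rw [errX, errFinal, if_pos hs.1, if_pos hs.1]
  have h1 := le_abs_self (it.fx - p.f it.x)
  have h2 := neg_abs_le (it.fsFinal p q - p.f (it.xs p q))
  unfold ared at h
  linarith

/-- The final trial point is the first or the corrected one, so accuracy is needed at both. -/
lemma err_le_of_accurate (hacc : it.Accepts p q)
    (h1 : it.ValueAccurate p q) (h2 : it.SocValueAccurate p q) :
    it.errX p q + it.errFinal p q ≤ 2 * q.κf * it.Δ ^ ((q.α : ℕ) + 2) := by
  rw [errX, errFinal, if_pos hacc, if_pos hacc]
  have h3 := max_le_iff.1 (h1 hacc)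
  by_cases hs : it.Soc p q
  · have h4 := h2 hs
    rw [fsFinal, xs, if_pos hs, if_pos hs]
    linarith [h3.1]
  · rw [fsFinal, xs, if_neg hs, if_neg hs]
    linarith [h3.1, h3.2]

/-- The correction step solves for a Taylor remainder of the constraints, so its length is of order
Δ², and one factor Δ is replaced by Δmax. -/
lemma Valid.norm_xs_sub_le (hreg : Regularity p K O) (hb : BoundedAt p K O it.x)
    (hv : it.Valid p q) (hΔ : 0 ≤ it.Δ) (hle : it.Δ ≤ q.Δmax) (hacc : it.Accepts p q)
    (htr : it.trial p q ∈ O) :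
    ‖it.xs p q - it.x‖ ≤ (2 + √K.κ2G * (K.κ1G⁻¹ * (K.LG * (4 * q.Δmax)))) * it.Δ := by
  have hst := hv.norm_step_le hΔ hacc
  have hκ := hreg.κ1G_pos
  have hΔm := hΔ.trans hle
  have h0 : it.trial p q - it.x = it.step p q := by simp [trial]
  have h1 : ‖p.c (it.trial p q) - p.c it.x - p.jac it.x (it.step p q)‖
      ≤ K.LG * (4 * q.Δmax) * it.Δ := by
    have := hreg.norm_sub_taylor_c_le hb.mem htr
    rw [h0] at this
    calc _ ≤ K.LG * ‖it.step p q‖ ^ 2 := this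
      _ ≤ K.LG * (2 * it.Δ) ^ 2 := by gcongr
      _ = K.LG * (4 * it.Δ) * it.Δ := by ring
      _ ≤ K.LG * (4 * q.Δmax) * it.Δ := by gcongr
  have h2 : ‖it.socStep p q‖ ≤ √K.κ2G * (K.κ1G⁻¹ * (K.LG * (4 * q.Δmax) * it.Δ)) := by
    rw [socStep, norm_neg]
    refine (ContinuousLinearMap.le_opNorm _ _).trans ?_
    rw [LinearIsometryEquiv.norm_map]
    gcongr
    · exact hb.norm_jac_le
    · exact (ContinuousLinearMap.le_opNorm _ _).trans
        (mul_le_mul (hb.norm_gramInv_le hreg) h1 (norm_nonneg _) (by positivity))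
  have h3 : 0 ≤ √K.κ2G * (K.κ1G⁻¹ * (K.LG * (4 * q.Δmax) * it.Δ)) := by positivity
  unfold xs
  split_ifs
  · rw [add_sub_right_comm, h0]
    refine (norm_add_le _ _).trans ((add_le_add hst h2).trans (le_of_eq (by ring)))
  · rw [h0]; nlinarith

end Iteration

/-- A bound on the Hessian approximations of iterations with accurate estimates. -/
def hessBound (m : ℕ) (q : Params) (K : Constants) : ℝ :=
  max K.κB (q.κh * q.Δmax + K.LgradF +
    m * (K.κ1G⁻¹ * (√K.κ2G * (q.κg * q.Δmax ^ 2 + K.κgradF)) * K.LG))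

lemma one_le_hessBound (hreg : Regularity p K O) : 1 ≤ hessBound m q K :=
  hreg.one_le_κB.trans (le_max_left _ _)

namespace Iteration

/-- The estimates of the derivatives are accurate. -/
def ModelAccurate (p : Problem d m) (q : Params) (it : Iteration d m) : Prop :=
  (q.α = 1 → it.HessAccurate p q) ∧ it.GradAccurate p q

/-- For α = 1, accurate estimates bound the gradient, hence the multiplier, hence the Lagrangian
Hessian. The constant only affects how small a radius guarantees success, so a coarser one than
`kappaB` will do. -/
lemma Valid.norm_H_le (hq : q.Valid) (hreg : Regularity p K O) (hb : BoundedAt p K O it.x)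
    (hv : it.Valid p q) (hΔ : 0 ≤ it.Δ) (hle : it.Δ ≤ q.Δmax)
    (hH : q.α = 0 → ‖it.H‖ ≤ K.κB) (hacc : it.ModelAccurate p q) :
    ‖it.H‖ ≤ hessBound m q K := by
  rcases (by lia : q.α = 0 ∨ q.α = 1) with hα | hα
  · exact (hH hα).trans (le_max_left _ _)
  refine le_trans ?_ (le_max_right _ _)
  have hκ := hreg.κ1G_pos
  have hκg := hq.κg_pos
  have hκh := hq.κh_pos
  have h1 : ‖it.g‖ ≤ q.κg * q.Δmax ^ 2 + K.κgradF := by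
    have h := hacc.2
    rw [GradAccurate, hα] at h
    have h' : q.κg * it.Δ ^ (((1 : Fin 2) : ℕ) + 1) ≤ q.κg * q.Δmax ^ 2 := by
      change q.κg * it.Δ ^ 2 ≤ _
      gcongr
    have h2 := norm_add_le (it.g - gradient p.f it.x) (gradient p.f it.x)
    rw [sub_add_cancel] at h2
    linarith [hb.grad_le]
  have h2 : ‖p.multiplier it.x it.g‖ ≤
      K.κ1G⁻¹ * (√K.κ2G * (q.κg * q.Δmax ^ 2 + K.κgradF)) := by
    rw [Problem.multiplier, norm_neg]
    refine (ContinuousLinearMap.le_opNorm _ _).trans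
      (mul_le_mul (hb.norm_gramInv_le hreg) ?_ (norm_nonneg _) (by positivity))
    exact (ContinuousLinearMap.le_opNorm _ _).trans
      (mul_le_mul hb.norm_jac_le h1 (norm_nonneg _) (Real.sqrt_nonneg _))
  rw [hv.H_eq hα]
  refine (norm_add_le _ _).trans (add_le_add ?_ ?_)
  · have h3 := norm_add_le (it.hessF - hessian p.f it.x) (hessian p.f it.x)
    rw [sub_add_cancel] at h3
    have h4 : ‖it.hessF - hessian p.f it.x‖ ≤ q.κh * it.Δ := hacc.1 hα
    have h5 : q.κh * it.Δ ≤ q.κh * q.Δmax := by gcongr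
    linarith [hreg.norm_hessian_f_le hb.mem]
  · refine (norm_sum_le_of_le (f := fun i : Fin m => _) (n := fun _ => _) Finset.univ
      fun i _ => ?_).trans (le_of_eq (by
        rw [Finset.sum_const, Finset.card_univ, Fintype.card_fin, nsmul_eq_mul]))
    rw [norm_smul]
    exact mul_le_mul ((PiLp.norm_apply_le (p := 2) _ i).trans h2)
      (hreg.norm_hessian_c_le hb.mem i) (norm_nonneg _) ((norm_nonneg _).trans h2)

/-- The constant of the quadratic bound on the difference between actual and predicted
reduction. -/
def _root_.TRSQP.redBound (m : ℕ) (q : Params) (K : Constants) : ℝ :=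
  2 * q.κf * max 1 q.Δmax + 4 * K.LgradF + 2 * q.κg * max 1 q.Δmax + 2 * hessBound m q K +
    4 * |K.μhat| * K.LG

/-- Since the step is at most 2Δ, the value errors, both Taylor remainders, the gradient error times
the step and the quadratic term of the model are all of order Δ². This suffices because the
predicted reduction is of order Δ away from stationarity. -/
lemma Valid.aredFirst_le (hq : q.Valid) (hreg : Regularity p K O) (hb : BoundedAt p K O it.x)
    (hv : it.Valid p q) (hΔ : 0 ≤ it.Δ) (hle : it.Δ ≤ q.Δmax)
    (hH : ‖it.H‖ ≤ hessBound m q K) (hμ0 : 0 ≤ it.μ) (hμ : it.μ ≤ K.μhat)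
    (hg : it.GradAccurate p q) (hf : it.ValueAccurate p q)
    (hacc : it.Accepts p q) (htr : it.trial p q ∈ O) :
    it.aredFirst p q ≤ it.pred p q + redBound m q K * it.Δ ^ 2 := by
  have hst := hv.norm_step_le hΔ hacc
  have hκg := hq.κg_pos
  have hκf := hq.κf_pos
  set s := it.step p q with hs
  have h0 : it.trial p q - it.x = s := by simp [trial, hs]
  have hsq : ‖s‖ ^ 2 ≤ 4 * it.Δ ^ 2 := by
    nlinarith [norm_nonneg s]
  have h1 := hreg.abs_sub_taylor_f_le hb.mem htr
  have h2 := hreg.norm_sub_taylor_c_le hb.mem htr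
  rw [h0] at h1 h2
  have h1' : K.LgradF * ‖s‖ ^ 2 ≤ K.LgradF * (4 * it.Δ ^ 2) := by gcongr
  have h3 : ‖p.c (it.trial p q)‖ ≤ ‖p.c it.x + p.jac it.x s‖ + K.LG * (4 * it.Δ ^ 2) := by
    have h := norm_add_le (p.c (it.trial p q) - p.c it.x - p.jac it.x s)
      (p.c it.x + p.jac it.x s)
    rw [show p.c (it.trial p q) - p.c it.x - p.jac it.x s + (p.c it.x + p.jac it.x s) =
      p.c (it.trial p q) by abel] at h
    have : K.LG * ‖s‖ ^ 2 ≤ K.LG * (4 * it.Δ ^ 2) := by gcongr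
    linarith
  have h4 : it.μ * ‖p.c (it.trial p q)‖ ≤ it.μ * ‖p.c it.x + p.jac it.x s‖ +
      4 * |K.μhat| * K.LG * it.Δ ^ 2 := by
    have h5 : it.μ * (K.LG * (4 * it.Δ ^ 2)) ≤ |K.μhat| * (K.LG * (4 * it.Δ ^ 2)) := by
      gcongr
      exact hμ.trans (le_abs_self _)
    nlinarith [mul_le_mul_of_nonneg_left h3 hμ0]
  have h5 := max_le_iff.1 (hf hacc)
  have h6 : q.κf * it.Δ ^ ((q.α : ℕ) + 2) ≤ q.κf * (max 1 q.Δmax * it.Δ ^ 2) := by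
    gcongr
    exact pow_alpha_add_le q 2 hΔ hle
  have h7 : ⟪gradient p.f it.x, s⟫_ℝ - ⟪it.g, s⟫_ℝ ≤ 2 * q.κg * max 1 q.Δmax * it.Δ ^ 2 := by
    rw [← inner_sub_left]
    have h8 : ‖gradient p.f it.x - it.g‖ ≤ q.κg * (max 1 q.Δmax * it.Δ) := by
      rw [norm_sub_rev]
      refine hg.trans ?_
      have := pow_alpha_add_le q 1 hΔ hle
      rw [pow_one] at this
      gcongr
    calc _ ≤ ‖gradient p.f it.x - it.g‖ * ‖s‖ := real_inner_le_norm _ _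
      _ ≤ q.κg * (max 1 q.Δmax * it.Δ) * (2 * it.Δ) := by gcongr
      _ = _ := by ring
  have h9 : -(1 / 2 * ⟪s, it.H s⟫_ℝ) ≤ 2 * hessBound m q K * it.Δ ^ 2 := by
    have h10 : |⟪s, it.H s⟫_ℝ| ≤ hessBound m q K * (4 * it.Δ ^ 2) := by
      calc |⟪s, it.H s⟫_ℝ| ≤ ‖s‖ * ‖it.H s‖ := abs_real_inner_le_norm _ _
        _ ≤ ‖s‖ * (‖it.H‖ * ‖s‖) := by gcongr; exact it.H.le_opNorm s
        _ = ‖it.H‖ * ‖s‖ ^ 2 := by ring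
        _ ≤ _ := mul_le_mul hH hsq (sq_nonneg _) ((norm_nonneg _).trans hH)
    linarith [neg_abs_le ⟪s, it.H s⟫_ℝ]
  have e1 := abs_le.1 h1
  have e2 := abs_le.1 h5.1
  have e3 := abs_le.1 h5.2
  unfold aredFirst pred predAt redBound
  rw [← hs]
  nlinarith [e1.2, e2.1, e3.2]

/-- If the radius is small compared to the KKT residual, then an iteration with accurate
estimates is successful, and its predicted reduction is proportional to the radius. -/
lemma _root_.TRSQP.exists_radius_successful (hq : q.Valid) (hreg : Regularity p K O)
    {ε : ℝ} (hε : 0 < ε) :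
    ∃ δ : ℝ, 0 < δ ∧ ∀ it : Iteration d m, it.Valid p q → BoundedAt p K O it.x →
      0 < it.Δ → it.Δ ≤ q.Δmax → it.Δ ≤ δ → (q.α = 0 → ‖it.H‖ ≤ K.κB) → 0 ≤ it.μ →
      it.μ ≤ K.μhat → (it.Accepts p q → it.trial p q ∈ O) → it.ModelAccurate p q →
      it.ValueAccurate p q → ε ≤ p.kktResidual it.x →
      it.Successful p q ∧ q.κfcd * ε / 4 * it.Δ ≤ -it.pred p q := by
  have hB := one_le_hessBound (q := q) hreg
  have hP := projBound_pos hreg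
  have hκg := hq.κg_pos
  have hκf := hq.κf_pos
  have hκ := hq.κfcd_mem.1
  have hη := hq.η_mem
  have h1η : 0 < 1 - q.η := by linarith [hη.2]
  have hR : 0 < redBound m q K := by
    unfold redBound
    have := hB
    positivity
  -- The first bound keeps the estimated residual above ε/2. The second makes the test of Step 2
  -- pass and makes Δ the minimum in the gradient reduction. The third makes the quadratic model
  -- error at most a fraction 1 - η of the predicted reduction.
  refine ⟨min (ε / (2 * (projBound K * (q.κg * max 1 q.Δmax)))) (min (ε / (2 * hessBound m q K))
    ((1 - q.η) * (q.κfcd * ε / 4) / redBound m q K)), by positivity, ?_⟩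
  intro it hv hb hΔ hle hδ hH0 hμ0 hμ htr hmod hval hres
  obtain ⟨hδ1, hδ2, hδ3⟩ : _ ∧ _ ∧ _ := by simpa only [le_min_iff] using hδ
  rw [le_div_iff₀ (by positivity)] at hδ1 hδ2 hδ3
  have hH := hv.norm_H_le hq hreg hb hΔ.le hle hH0 hmod
  have hkkt : ε / 2 ≤ it.kktEst p := by
    have h1 := (abs_le.1 (hb.abs_kktNorm_sub_le hreg it.g (gradient p.f it.x))).1
    have h2 : projBound K * ‖it.g - gradient p.f it.x‖ ≤
        projBound K * (q.κg * (max 1 q.Δmax * it.Δ)) := by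
      gcongr
      refine le_trans hmod.2 ?_
      have := pow_alpha_add_le q 1 hΔ.le hle
      rw [pow_one] at this
      gcongr
    rw [kktEst]
    unfold Problem.kktResidual at hres
    nlinarith
  have hacc : it.Accepts p q := by
    refine le_max_of_le_left ((le_div_iff₀ (by positivity)).2 ?_)
    calc q.η * it.Δ * max 1 ‖it.H‖ ≤ 1 * it.Δ * hessBound m q K := by
          gcongr
          · exact hη.2.le
          · exact max_le hB hH
      _ ≤ it.kktEst p := by linarith
  have hpred : q.κfcd * ε / 4 * it.Δ ≤ -it.pred p q := by
    have h1 : it.Δ ≤ minRatio it.Δ (it.kktEst p) ‖it.H‖ := by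
      refine le_minRatio (norm_nonneg _) le_rfl ?_
      have : it.Δ * ‖it.H‖ ≤ it.Δ * hessBound m q K := by gcongr
      linarith
    have h2 : ε / 2 * it.Δ ≤ it.gradReduction p :=
      mul_le_mul hkkt h1 hΔ.le kktEst_nonneg
    nlinarith [hv.gradReduction_le hq hacc]
  refine ⟨⟨hacc, ?_⟩, hpred⟩
  have hneg := hv.pred_neg hq hΔ hle hacc
  have hfirst : q.η ≤ it.aredFirst p q / it.pred p q := by
    rw [le_div_iff_of_neg hneg]
    have h1 := hv.aredFirst_le hq hreg hb hΔ.le hle hH hμ0 hμ hmod.2 hval hacc (htr hacc)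
    nlinarith
  -- The first trial point already passes, so no correction is tried and the final ratio is the
  -- first one.
  have hsoc : ¬ it.Soc p q := fun h => h.2.1 hfirst
  have heq : it.ared p q = it.aredFirst p q := by
    rw [ared, aredFirst, fsFinal, xs, if_neg hsoc, if_neg hsoc]
  rwa [heq]

end Iteration

end SingleIteration

/-! ### The potential function -/

section Potential

variable {d m : ℕ} {p : Problem d m} {q : Params} {K : Constants} {O : Set (Vec d)} {ν : ℝ}

lemma kappaB_pos (hreg : Regularity p K O) : 0 < kappaB m q K := by
  unfold kappaB; split_ifs
  · exact zero_lt_one.trans_le hreg.one_le_κB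
  · exact zero_lt_one.trans_le (le_max_left _ _)

lemma Upsilon3_pos (hq : q.Valid) (hreg : Regularity p K O) : 0 < Upsilon3 m q K := by
  have h1 := kappaB_pos (q := q) hreg
  have h2 := hq.κg_pos
  have h3 := hq.κfcd_mem.1
  unfold Upsilon3
  refine mul_pos (by positivity) (lt_max_of_lt_left (by positivity))

/-- This is the form in which the merit decrease pays for the growth of Δ^(α+2); positivity of
`Upsilon3` is what allows the denominator to be cleared. -/
lemma WeightCond.radius_le (hν : WeightCond m q K ν) (hq : q.Valid) (hreg : Regularity p K O) :
    4 * q.γ ^ 3 * max 1 q.Δmax * (1 - ν) ≤ ν * (q.η ^ 3 * q.κfcd) := by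
  have h1 : 0 < 1 - ν := by linarith [hν.1.2]
  have h2 : 0 < q.η ^ 3 * q.κfcd := mul_pos (pow_pos hq.η_mem.1 3) hq.κfcd_mem.1
  have h3 : 0 < min (q.η ^ 3 * q.κfcd) (Upsilon3 m q K) := lt_min h2 (Upsilon3_pos hq hreg)
  have h := (le_max_left _ _).trans hν.2
  rw [div_le_div_iff₀ h3 h1] at h
  exact h.trans (mul_le_mul_of_nonneg_left (min_le_left _ _) hν.1.1.le)

lemma WeightCond.reliability_le (hν : WeightCond m q K ν) (hq : q.Valid) :
    2 * q.γ * (1 - ν) ≤ ν * q.η := by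
  have h1 : 0 < 1 - ν := by linarith [hν.1.2]
  have h := (le_max_right _ _).trans hν.2
  rwa [div_le_div_iff₀ hq.η_mem.1 h1] at h

/-- The potential function, for the merit parameter `b`. -/
def potential (p : Problem d m) (q : Params) (K : Constants) (ν b : ℝ) (it : Iteration d m) : ℝ :=
  ν * (p.f it.x - K.fInf + b * ‖p.c it.x‖) +
    (1 - ν) / 2 * (it.Δ ^ ((q.α : ℕ) + 2) + it.ε)

/-- The rate at which the potential function decreases. -/
def decayRate (q : Params) (ν : ℝ) : ℝ := (1 - ν) / 2 * (1 - 1 / q.γ)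

lemma decayRate_pos (hq : q.Valid) (hν : WeightCond m q K ν) : 0 < decayRate q ν := by
  have h1 := hν.1.2
  have h2 : 1 / q.γ < 1 := (div_lt_one (by linarith [hq.one_lt_γ])).2 hq.one_lt_γ
  exact mul_pos (by linarith) (by linarith)

lemma potential_nonneg (hreg : Regularity p K O) (hν : WeightCond m q K ν) {b : ℝ} (hb : 0 ≤ b)
    {it : Iteration d m} (hx : it.x ∈ O) (hΔ : 0 ≤ it.Δ) (hε : 0 ≤ it.ε) :
    0 ≤ potential p q K ν b it := by
  have h1 := hreg.f_bddBelow _ hx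
  have h2 : 0 ≤ 1 - ν := by linarith [hν.1.2]
  exact add_nonneg (mul_nonneg hν.1.1.le (add_nonneg (by linarith) (by positivity)))
    (by positivity)

variable {it nx : Iteration d m}

/-- The iterate stays, ε is divided by γ, and Δ^(α+2) by at least γ. -/
lemma potential_le_of_not_successful (hq : q.Valid) (hν : WeightCond m q K ν)
    (hΔ : 0 < it.Δ) (hnx : it.Next p q nx) (hs : ¬ it.Successful p q) (b : ℝ) :
    potential p q K ν b nx + decayRate q ν * (it.Δ ^ ((q.α : ℕ) + 2) + it.ε) ≤
      potential p q K ν b it := by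
  have hγ := hq.one_lt_γ
  have hγ0 : 0 < q.γ := by linarith
  have h1 : (it.Δ / q.γ) ^ ((q.α : ℕ) + 2) ≤ it.Δ ^ ((q.α : ℕ) + 2) * (1 / q.γ) := by
    rw [div_pow, div_eq_mul_one_div]
    gcongr
    exact le_self_pow₀ hγ.le (by lia)
  have h2 : 0 ≤ (1 - ν) / 2 := by linarith [hν.1.2]
  rw [potential, potential, decayRate, hnx.x_unsucc hs, hnx.Δ_unsucc hs, hnx.ε_unsucc hs]
  have h3 := mul_le_mul_of_nonneg_left h1 h2
  rw [div_eq_mul_one_div it.ε]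
  linarith

/-- The weighted merit decrease is νη times the predicted reduction. One quarter of it pays for the
growth of Δ^(α+2), one quarter for that of ε, and one half is left to absorb errors or to count as a
gain. -/
lemma potential_le_of_successful (hq : q.Valid) (hreg : Regularity p K O)
    (hν : WeightCond m q K ν) (hv : it.Valid p q)
    (hΔ : 0 < it.Δ) (hle : it.Δ ≤ q.Δmax) (hε : 0 < it.ε) (hnx : it.Next p q nx)
    (hnxΔ : 0 ≤ nx.Δ) (hs : it.Successful p q) :
    potential p q K ν it.μ nx + decayRate q ν * (it.Δ ^ ((q.α : ℕ) + 2) + it.ε) +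
      ν * q.η / 2 * -it.pred p q ≤
      potential p q K ν it.μ it + ν * (it.errX p q + it.errFinal p q) := by
  have hγ := hq.one_lt_γ
  have hγ0 : 0 < q.γ := by linarith
  have hη := hq.η_mem.1
  have hν0 := hν.1.1
  have h1ν : 0 < 1 - ν := by linarith [hν.1.2]
  have hpred := hv.pred_neg hq hΔ hle hs.1
  have hM : 0 < max 1 q.Δmax := by positivity
  have hD := hv.pow_radius_le_neg_pred hq hΔ hle hs.1
  have hmerit := mul_le_mul_of_nonneg_left (hv.merit_le_of_successful hq hΔ hle hs) hν0.le
  have hnxD : nx.Δ ^ ((q.α : ℕ) + 2) ≤ q.γ ^ 3 * it.Δ ^ ((q.α : ℕ) + 2) := by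
    have h1 : nx.Δ ≤ q.γ * it.Δ := by rw [hnx.Δ_succ hs]; exact min_le_left _ _
    refine (pow_le_pow_left₀ hnxΔ h1 _).trans ?_
    rw [mul_pow]
    gcongr
    · exact hγ.le
    · lia
  set D := it.Δ ^ ((q.α : ℕ) + 2) with hDdef
  have hD0 : 0 < D := by positivity
  set X := -it.pred p q with hX
  have hpX : it.pred p q = -X := by rw [hX, neg_neg]
  have hX0 : 0 < X := by linarith
  have hweight := hν.radius_le hq hreg
  have h1 : (1 - ν) * (q.γ ^ 3 * D) ≤ ν * q.η / 2 * X := by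
    have e1 : 4 * q.γ ^ 3 * max 1 q.Δmax * (1 - ν) * D ≤ ν * (q.η ^ 3 * q.κfcd) * D := by
      gcongr
    have e2 := mul_le_mul_of_nonneg_left hD (mul_pos hν0 hη).le
    refine le_of_mul_le_mul_left ?_ (mul_pos four_pos hM)
    linarith
  have hε' : nx.ε - it.ε * (1 / q.γ) ≤ q.γ * X := by
    have : 0 < it.ε * (1 / q.γ) := by positivity
    by_cases hr : it.Reliable p q
    · rw [hnx.ε_reliable hs hr]
      have : q.γ * it.ε ≤ q.γ * X := by gcongr; exact hr
      linarith
    · rw [hnx.ε_unreliable hs hr, div_eq_mul_one_div it.ε, sub_self]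
      positivity
  have h2 : (1 - ν) / 2 * (q.γ * X) ≤ ν * q.η / 4 * X := by
    have := mul_le_mul_of_nonneg_right (hν.reliability_le hq) hX0.le
    linarith
  have h3 := mul_le_mul_of_nonneg_left hε' (by linarith : 0 ≤ (1 - ν) / 2)
  have h4 := mul_le_mul_of_nonneg_left hnxD (by linarith : 0 ≤ (1 - ν) / 2)
  have h5 : 0 ≤ (1 - ν) / 2 * (D * (1 / q.γ)) := by positivity
  rw [potential, potential, decayRate, hnx.x_succ hs, ← hDdef]
  rw [hpX] at hmerit
  linarith

/-- Without any assumption on the accuracy of the estimates. -/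
lemma potential_le (hq : q.Valid) (hreg : Regularity p K O)
    (hν : WeightCond m q K ν) (hv : it.Valid p q)
    (hΔ : 0 < it.Δ) (hle : it.Δ ≤ q.Δmax) (hε : 0 < it.ε) (hnx : it.Next p q nx)
    (hnxΔ : 0 ≤ nx.Δ) :
    potential p q K ν it.μ nx + decayRate q ν * (it.Δ ^ ((q.α : ℕ) + 2) + it.ε) ≤
      potential p q K ν it.μ it + ν * (it.errX p q + it.errFinal p q) := by
  have h1 : 0 ≤ ν * (it.errX p q + it.errFinal p q) :=
    mul_nonneg hν.1.1.le (add_nonneg Iteration.errX_nonneg Iteration.errFinal_nonneg)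
  by_cases hs : it.Successful p q
  · have h2 := potential_le_of_successful hq hreg hν hv hΔ hle hε hnx hnxΔ hs
    have h3 := hv.pred_neg hq hΔ hle hs.1
    have h4 : 0 ≤ ν * q.η / 2 * -it.pred p q :=
      mul_nonneg (div_nonneg (mul_nonneg hν.1.1.le hq.η_mem.1.le) two_pos.le) (by linarith)
    linarith
  · have h2 := potential_le_of_not_successful hq hν hΔ hnx hs it.μ
    linarith

/-- A successful iteration with accurate estimates of the function values. -/
lemma potential_le_of_successful_of_accurate (hq : q.Valid) (hreg : Regularity p K O)
    (hν : WeightCond m q K ν) (hv : it.Valid p q)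
    (hΔ : 0 < it.Δ) (hle : it.Δ ≤ q.Δmax) (hε : 0 < it.ε) (hnx : it.Next p q nx)
    (hnxΔ : 0 ≤ nx.Δ) (hs : it.Successful p q)
    (hval : it.ValueAccurate p q) (hsoc : it.SocValueAccurate p q) :
    potential p q K ν it.μ nx + decayRate q ν * (it.Δ ^ ((q.α : ℕ) + 2) + it.ε) +
      ν * q.η / 4 * -it.pred p q ≤ potential p q K ν it.μ it := by
  have h1 := potential_le_of_successful hq hreg hν hv hΔ hle hε hnx hnxΔ hs
  have h2 := Iteration.err_le_of_accurate hs.1 hval hsoc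
  have hD := hv.pow_radius_le_neg_pred hq hΔ hle hs.1
  have hM : 0 < max 1 q.Δmax := by positivity
  have hκ := hq.κf_le
  rw [le_div_iff₀ (by positivity)] at hκ
  have hD0 : 0 < it.Δ ^ ((q.α : ℕ) + 2) := by positivity
  -- The admissible size of `κf` is used here: accurate values consume only half of the surplus νη/2
  -- times the predicted reduction.
  have h3 : 2 * q.κf * it.Δ ^ ((q.α : ℕ) + 2) ≤ q.η / 4 * -it.pred p q := by
    have e1 := mul_le_mul_of_nonneg_right hκ hD0.le
    have e2 := mul_le_mul_of_nonneg_left hD hq.η_mem.1.le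
    refine le_of_mul_le_mul_left ?_ (mul_pos (by norm_num : (0 : ℝ) < 16) hM)
    linarith
  have h4 := mul_le_mul_of_nonneg_left (h2.trans h3) hν.1.1.le
  linarith

/-- An iteration with accurate estimates of the function values. -/
lemma potential_le_of_accurate (hq : q.Valid) (hreg : Regularity p K O)
    (hν : WeightCond m q K ν) (hv : it.Valid p q)
    (hΔ : 0 < it.Δ) (hle : it.Δ ≤ q.Δmax) (hε : 0 < it.ε) (hnx : it.Next p q nx)
    (hnxΔ : 0 ≤ nx.Δ) (hval : it.ValueAccurate p q) (hsoc : it.SocValueAccurate p q) :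
    potential p q K ν it.μ nx + decayRate q ν * (it.Δ ^ ((q.α : ℕ) + 2) + it.ε) ≤
      potential p q K ν it.μ it := by
  by_cases hs : it.Successful p q
  · have h2 := potential_le_of_successful_of_accurate hq hreg hν hv hΔ hle hε hnx hnxΔ hs hval hsoc
    have h3 := hv.pred_neg hq hΔ hle hs.1
    have h4 : 0 ≤ ν * q.η / 4 * -it.pred p q :=
      mul_nonneg (div_nonneg (mul_nonneg hν.1.1.le hq.η_mem.1.le) four_pos.le) (by linarith)
    linarith
  · exact potential_le_of_not_successful hq hν hΔ hnx hs it.μ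

end Potential

/-! ### Runs of the algorithm -/

section Runs

variable {d m : ℕ} {p : Problem d m} {q : Params} {K : Constants} {O : Set (Vec d)}
  {x₀ : Vec d} {T : ℕ → Iteration d m}

lemma IsRun.radius_bounds (hq : q.Valid) (hT : IsRun p q x₀ T) (k : ℕ) :
    q.Δ₀ / q.γ ^ k ≤ (T k).Δ ∧ (T k).Δ ≤ q.Δmax := by
  have hγ := hq.one_lt_γ
  have hγ0 : 0 < q.γ := by linarith
  have hΔ := hq.Δ₀_mem
  induction k with
  | zero => simpa [hT.init_Δ] using hΔ.2.le
  | succ k ih =>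
    have h0 : q.Δ₀ / q.γ ^ (k + 1) ≤ q.Δ₀ :=
      div_le_self hΔ.1.le (one_le_pow₀ hγ.le)
    have h1 : 0 < (T k).Δ := lt_of_lt_of_le (div_pos hΔ.1 (pow_pos hγ0 k)) ih.1
    have h2 : q.Δ₀ / q.γ ^ (k + 1) ≤ (T k).Δ / q.γ := by
      rw [pow_succ, ← div_div]
      exact div_le_div_of_nonneg_right ih.1 hγ0.le
    have h3 : (T k).Δ / q.γ ≤ (T k).Δ := div_le_self h1.le hγ.le
    by_cases hs : (T k).Successful p q
    · rw [(hT.next k).Δ_succ hs]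
      refine ⟨le_min ?_ (h0.trans hΔ.2.le), min_le_right _ _⟩
      exact h2.trans (h3.trans (le_mul_of_one_le_left h1.le hγ.le))
    · rw [(hT.next k).Δ_unsucc hs]
      exact ⟨h2, h3.trans ih.2⟩

lemma IsRun.radius_pos (hq : q.Valid) (hT : IsRun p q x₀ T) (k : ℕ) : 0 < (T k).Δ :=
  lt_of_lt_of_le (div_pos hq.Δ₀_mem.1 (pow_pos (zero_lt_one.trans hq.one_lt_γ) k))
    (hT.radius_bounds hq k).1

/-- Deterministic bounds for each fixed iteration make ε integrable and 1/ε an admissible bounded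
weight. -/
lemma IsRun.reliability_bounds (hq : q.Valid) (hT : IsRun p q x₀ T) (k : ℕ) :
    q.ε₀ / q.γ ^ k ≤ (T k).ε ∧ (T k).ε ≤ q.ε₀ * q.γ ^ k := by
  have hγ := hq.one_lt_γ
  have hγ0 : 0 < q.γ := by linarith
  have hε := hq.ε₀_pos
  induction k with
  | zero => simp [hT.init_ε]
  | succ k ih =>
    have h1 : 0 < (T k).ε := lt_of_lt_of_le (div_pos hε (pow_pos hγ0 k)) ih.1
    have h2 : q.ε₀ / q.γ ^ (k + 1) ≤ (T k).ε / q.γ := by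
      rw [pow_succ, ← div_div]
      exact div_le_div_of_nonneg_right ih.1 hγ0.le
    have h3 : (T k).ε / q.γ ≤ (T k).ε := div_le_self h1.le hγ.le
    have h4 : (T k).ε ≤ q.γ * (T k).ε := le_mul_of_one_le_left h1.le hγ.le
    have h5 : q.γ * (T k).ε ≤ q.ε₀ * q.γ ^ (k + 1) := by
      rw [pow_succ, ← mul_assoc, mul_comm q.γ]
      exact mul_le_mul_of_nonneg_right ih.2 hγ0.le
    by_cases hs : (T k).Successful p q
    · by_cases hr : (T k).Reliable p q
      · rw [(hT.next k).ε_reliable hs hr]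
        exact ⟨h2.trans (h3.trans h4), h5⟩
      · rw [(hT.next k).ε_unreliable hs hr]
        exact ⟨h2, h3.trans (h4.trans h5)⟩
    · rw [(hT.next k).ε_unsucc hs]
      exact ⟨h2, h3.trans (h4.trans h5)⟩

lemma IsRun.reliability_pos (hq : q.Valid) (hT : IsRun p q x₀ T) (k : ℕ) : 0 < (T k).ε :=
  lt_of_lt_of_le (div_pos hq.ε₀_pos (pow_pos (zero_lt_one.trans hq.one_lt_γ) k))
    (hT.reliability_bounds hq k).1

lemma IsRun.merit_pos (hq : q.Valid) (hT : IsRun p q x₀ T) (k : ℕ) : 0 < (T k).μ := by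
  have hstep : ∀ j, 0 < (T j).μin → 0 < (T j).μ := fun j hj => by
    by_cases ha : (T j).Accepts p q
    · obtain ⟨i, -, hi⟩ := (hT.valid j).merit ha
      rw [hi]
      exact mul_pos (pow_pos (zero_lt_one.trans hq.one_lt_ρ) i) hj
    · rwa [(hT.valid j).merit_skip ha]
  refine hstep k ?_
  induction k with
  | zero => rw [hT.init_μ]; exact hq.μ₀_pos
  | succ k ih => rw [(hT.next k).μin_eq]; exact hstep k ih

lemma IterateBounds.boundedAt (hB : IterateBounds p q K O T) (k : ℕ) :
    BoundedAt p K O (T k).x :=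
  ⟨hB.x_mem k, hB.c_le k, hB.grad_le k, hB.gram_ge k, hB.gram_le k⟩

/-- A bound on the ratio of the length of a step to the radius. -/
def stepBound (q : Params) (K : Constants) : ℝ :=
  2 + √K.κ2G * (K.κ1G⁻¹ * (K.LG * (4 * q.Δmax)))

lemma stepBound_pos (hq : q.Valid) (hreg : Regularity p K O) : 0 < stepBound q K := by
  have h1 := hq.Δmax_pos
  have h2 := hreg.κ1G_pos
  unfold stepBound
  positivity

lemma IsRun.norm_x_sub_le (hq : q.Valid) (hreg : Regularity p K O) (hT : IsRun p q x₀ T)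
    (hB : IterateBounds p q K O T) (k : ℕ) :
    ‖(T (k + 1)).x - (T k).x‖ ≤ stepBound q K * (T k).Δ := by
  have hΔ := hT.radius_pos hq k
  by_cases hs : (T k).Successful p q
  · rw [(hT.next k).x_succ hs]
    exact (hT.valid k).norm_xs_sub_le hreg (hB.boundedAt k) hΔ.le (hT.radius_bounds hq k).2 hs.1
      (hB.trial_mem k hs.1)
  · rw [(hT.next k).x_unsucc hs, sub_self, norm_zero]
    exact (mul_pos (stepBound_pos hq hreg) hΔ).le

/-- A bound uniform over all runs is needed so that the potential at the starting index of the
telescoping sum has finite expectation. -/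
lemma exists_f_iterate_le (p : Problem d m) (x₀ : Vec d) (hq : q.Valid)
    (hreg : Regularity p K O) (k : ℕ) :
    ∃ N : ℝ, ∀ T : ℕ → Iteration d m, IsRun p q x₀ T → IterateBounds p q K O T →
      p.f (T k).x ≤ N := by
  induction k with
  | zero => exact ⟨p.f x₀, fun T hT _ => by rw [hT.init_x]⟩
  | succ k ih =>
    obtain ⟨N, hN⟩ := ih
    refine ⟨N + K.κgradF * (stepBound q K * q.Δmax) +
      K.LgradF * (stepBound q K * q.Δmax) ^ 2, fun T hT hB => ?_⟩
    have h1 := (abs_le.1 (hreg.abs_sub_taylor_f_le (hB.x_mem k) (hB.x_mem (k + 1)))).2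
    have h2 : ‖(T (k + 1)).x - (T k).x‖ ≤ stepBound q K * q.Δmax :=
      (hT.norm_x_sub_le hq hreg hB k).trans
        (mul_le_mul_of_nonneg_left (hT.radius_bounds hq k).2 (stepBound_pos hq hreg).le)
    have h3 := (real_inner_le_norm (gradient p.f (T k).x) ((T (k + 1)).x - (T k).x)).trans
      (mul_le_mul (hB.grad_le k) h2 (norm_nonneg _) hreg.κgradF_pos.le)
    have h4 : K.LgradF * ‖(T (k + 1)).x - (T k).x‖ ^ 2 ≤
      K.LgradF * (stepBound q K * q.Δmax) ^ 2 := by gcongr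
    linarith [hN T hT hB]

end Runs

/-- A nonnegative sequence tends to zero if it is repeatedly small and its increments are
controlled by a null sequence that is summable over the indices where the sequence is large. -/
lemma tendsto_zero_of_summable_on_large {r Δ : ℕ → ℝ} {C : ℝ} (hr : ∀ k, 0 ≤ r k)
    (hC : 0 ≤ C) (hΔ : ∀ k, 0 ≤ Δ k) (hinc : ∀ k, r (k + 1) ≤ r k + C * Δ k)
    (hlim : Tendsto Δ atTop (𝓝 0))
    (h : ∀ n : ℕ, (∃ᶠ k in atTop, r k < 1 / ((n : ℝ) + 1)) ∧
      Summable fun k => {k | 1 / ((n : ℝ) + 1) ≤ r k}.indicator Δ k) :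
    Tendsto r atTop (𝓝 0) := by
  refine tendsto_order.2 ⟨fun a ha => Eventually.of_forall fun k => ha.trans_le (hr k),
    fun a ha => ?_⟩
  obtain ⟨n, hn⟩ := exists_nat_one_div_lt (show 0 < a / 3 by linarith)
  obtain ⟨hfreq, hsum⟩ := h n
  set ε : ℝ := 1 / ((n : ℝ) + 1) with hε
  have hε0 : 0 < ε := by positivity
  set I : ℕ → ℝ := fun k => {k | ε ≤ r k}.indicator Δ k with hI
  have hI0 : ∀ k, 0 ≤ I k := fun k => Set.indicator_nonneg (fun i _ => hΔ i) k
  have htail : ∀ᶠ K in atTop, C * ∑' k, I (k + K) < ε := by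
    have h1 : Tendsto (fun K => C * ∑' k, I (k + K)) atTop (𝓝 (C * 0)) :=
      (tendsto_sum_nat_add I).const_mul C
    rw [mul_zero] at h1
    exact h1.eventually (gt_mem_nhds hε0)
  have hsmall : ∀ᶠ K in atTop, ∀ k ≥ K, C * Δ k < ε := by
    have h1 : Tendsto (fun k => C * Δ k) atTop (𝓝 (C * 0)) := hlim.const_mul C
    rw [mul_zero] at h1
    exact eventually_forall_ge_atTop.2 (h1.eventually (gt_mem_nhds hε0))
  obtain ⟨K, hK, hK1, hK2⟩ := (hfreq.and_eventually (htail.and hsmall)).exists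
  -- Below ε, one increment cannot lead above 2ε; at or above ε, the increment is counted in the
  -- sum. The tail adds less than ε, hence the choice of ε below a/3.
  have hbound : ∀ j, r (K + j) ≤ 2 * ε + C * ∑ i ∈ Finset.range j, I (i + K) := by
    intro j
    induction j with
    | zero => simp only [add_zero, Finset.range_zero, Finset.sum_empty, mul_zero]; linarith
    | succ j ih =>
      rw [Finset.sum_range_succ, mul_add, ← add_assoc K j 1]
      have h1 := hinc (K + j)
      have h2 : 0 ≤ C * ∑ i ∈ Finset.range j, I (i + K) :=
        mul_nonneg hC (Finset.sum_nonneg fun i _ => hI0 _)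
      by_cases hj : ε ≤ r (K + j)
      · have h3 : I (j + K) = Δ (K + j) := by
          rw [hI, add_comm j K]; exact Set.indicator_of_mem (s := {k | ε ≤ r k}) hj Δ
        rw [h3]; linarith
      · have h3 := hK2 (K + j) (by lia)
        have h4 := mul_nonneg hC (hI0 (j + K))
        push Not at hj
        linarith
  filter_upwards [eventually_ge_atTop K] with k hk
  obtain ⟨j, rfl⟩ := Nat.exists_eq_add_of_le hk
  have h1 : ∑ i ∈ Finset.range j, I (i + K) ≤ ∑' i, I (i + K) :=
    ((summable_nat_add_iff K).2 hsum).sum_le_tsum _ fun i _ => hI0 _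
  have h2 := mul_le_mul_of_nonneg_left h1 hC
  linarith [hbound j]

/-! ### Auxiliary facts on conditional expectations and adapted sequences -/

section Probability

variable {Ω : Type*} {𝓖 𝓖' : MeasurableSpace Ω} {m₀ : MeasurableSpace Ω} {P : Measure Ω}

/-- A conditional inequality is tested against a bounded nonnegative weight by pulling the weight
into the conditional expectation. -/
lemma integral_mul_le_of_condExp_le [IsFiniteMeasure P] (hm : 𝓖 ≤ m₀)
    {h X Y : Ω → ℝ} (hh : StronglyMeasurable[𝓖] h) (h0 : ∀ᵐ ω ∂P, 0 ≤ h ω)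
    {B : ℝ} (hB : ∀ᵐ ω ∂P, h ω ≤ B) (hX : Integrable X P) (hY : Integrable Y P)
    (hXY : ∀ᵐ ω ∂P, (P[X | 𝓖]) ω ≤ Y ω) :
    ∫ ω, h ω * X ω ∂P ≤ ∫ ω, h ω * Y ω ∂P := by
  have hbd : ∀ᵐ ω ∂P, ‖h ω‖ ≤ B := by
    filter_upwards [h0, hB] with ω h1 h2
    rwa [Real.norm_of_nonneg h1]
  have hms := (hh.mono hm).aestronglyMeasurable (μ := P)
  have hhX : Integrable (h * X) P := hX.bdd_mul hms hbd
  have hhY : Integrable (h * Y) P := hY.bdd_mul hms hbd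
  have h1 : ∫ ω, (P[h * X | 𝓖]) ω ∂P = ∫ ω, (h * X) ω ∂P := integral_condExp hm
  have h2 := condExp_mul_of_stronglyMeasurable_left hh hhX hX
  calc ∫ ω, h ω * X ω ∂P = ∫ ω, (P[h * X | 𝓖]) ω ∂P := h1.symm
    _ ≤ ∫ ω, (h * Y) ω ∂P := by
        refine integral_mono_ae integrable_condExp hhY ?_
        filter_upwards [h2, hXY, h0] with ω e1 e2 e3
        rw [e1]
        exact mul_le_mul_of_nonneg_left e2 e3

/-- The event `E` has probability at least `1 - p` conditionally on every event of `𝓖`. -/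
structure LikelyGiven (𝓖 : MeasurableSpace Ω) {m₀ : MeasurableSpace Ω} (P : Measure Ω) (p : ℝ)
    (E : Set Ω) : Prop where
  nullMeasurableSet : NullMeasurableSet E P
  integral_compl_le : ∀ h : Ω → ℝ, StronglyMeasurable[𝓖] h → (∀ᵐ ω ∂P, 0 ≤ h ω) →
    (∃ B, ∀ᵐ ω ∂P, h ω ≤ B) → ∫ ω, Eᶜ.indicator h ω ∂P ≤ p * ∫ ω, h ω ∂P

lemma LikelyGiven.of_condExp [IsProbabilityMeasure P] (hm : 𝓖 ≤ m₀)
    {p : ℝ} (hp : p < 1) {E : Set Ω} (hE : ∀ᵐ ω ∂P, 1 - p ≤ (P⟦E | 𝓖⟧) ω) :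
    LikelyGiven 𝓖 P p E := by
  -- Measurability of `E` is not assumed. A nonintegrable indicator would have conditional
  -- expectation 0 by default, contradicting the positive lower bound 1 - p.
  have hint : Integrable (E.indicator fun _ => (1 : ℝ)) P := by
    by_contra hni
    rw [condExp_of_not_integrable hni] at hE
    obtain ⟨ω, hω⟩ := hE.exists
    rw [Pi.zero_apply] at hω
    linarith
  have hnm : NullMeasurableSet E P :=
    (aemeasurable_indicator_const_iff (1 : ℝ)).1 hint.aemeasurable
  refine ⟨hnm, fun h hh h0 ⟨B, hB⟩ => ?_⟩
  have hi : Integrable h P := Integrable.of_bound (hh.mono hm).aestronglyMeasurable B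
    (by filter_upwards [h0, hB] with ω h1 h2; rwa [Real.norm_of_nonneg h1])
  have h1 : ∫ ω, h ω * -(E.indicator (fun _ => (1 : ℝ)) ω) ∂P ≤ ∫ ω, h ω * -(1 - p) ∂P := by
    refine integral_mul_le_of_condExp_le hm hh h0 hB hint.neg (integrable_const _) ?_
    filter_upwards [hE, condExp_neg (μ := P) (E.indicator fun _ => (1 : ℝ)) 𝓖] with ω e1 e2
    change (P[-(E.indicator fun _ => (1 : ℝ)) | 𝓖]) ω ≤ _
    rw [e2, Pi.neg_apply]
    linarith
  have h2 : ∀ ω, Eᶜ.indicator h ω = h ω + h ω * -(E.indicator (fun _ => (1 : ℝ)) ω) := by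
    intro ω
    by_cases hω : ω ∈ E <;> simp [hω]
  have h3 : Integrable (fun ω => h ω * -(E.indicator (fun _ => (1 : ℝ)) ω)) P := by
    have h4 := hi.indicator₀ hnm
    refine h4.neg.congr (Eventually.of_forall fun ω => ?_)
    by_cases hω : ω ∈ E <;> simp [hω]
  simp_rw [h2]
  rw [integral_add hi h3]
  rw [integral_mul_const] at h1
  linarith

lemma LikelyGiven.mono (hle : 𝓖' ≤ 𝓖) {p : ℝ}
    {E : Set Ω} (hE : LikelyGiven 𝓖 P p E) : LikelyGiven 𝓖' P p E :=
  ⟨hE.1, fun h hh => hE.2 h (hh.mono hle)⟩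

/-- Conditional union bound for the complements. -/
lemma LikelyGiven.inter [IsFiniteMeasure P] (hm : 𝓖 ≤ m₀) {p p' : ℝ}
    {E E' : Set Ω} (hE : LikelyGiven 𝓖 P p E) (hE' : LikelyGiven 𝓖 P p' E') :
    LikelyGiven 𝓖 P (p + p') (E ∩ E') := by
  refine ⟨hE.1.inter hE'.1, fun h hh h0 ⟨B, hB⟩ => ?_⟩
  have hi : Integrable h P := Integrable.of_bound (hh.mono hm).aestronglyMeasurable B
    (by filter_upwards [h0, hB] with ω h1 h2; rwa [Real.norm_of_nonneg h1])
  have h1 : ∫ ω, (E ∩ E')ᶜ.indicator h ω ∂P ≤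
      ∫ ω, (Eᶜ.indicator h ω + E'ᶜ.indicator h ω) ∂P := by
    refine integral_mono_ae (hi.indicator₀ (hE.1.inter hE'.1).compl)
      ((hi.indicator₀ hE.1.compl).add (hi.indicator₀ hE'.1.compl)) ?_
    filter_upwards [h0] with ω e
    by_cases h1 : ω ∈ E <;> by_cases h2 : ω ∈ E' <;> simp [h1, h2, e]
  rw [integral_add (hi.indicator₀ hE.1.compl) (hi.indicator₀ hE'.1.compl)] at h1
  have h2 := hE.2 h hh h0 ⟨B, hB⟩
  have h3 := hE'.2 h hh h0 ⟨B, hB⟩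
  linarith

lemma LikelyGiven.univ {p : ℝ} (hp : 0 ≤ p) :
    LikelyGiven 𝓖 P p Set.univ := by
  refine ⟨.univ, fun h _ h0 _ => ?_⟩
  simp only [Set.compl_univ, Set.indicator_empty, integral_zero]
  exact mul_nonneg hp (integral_nonneg_of_ae h0)

/-- On unlikely events, errors with small conditional second moment have a small expectation. -/
lemma integral_error_indicator_le [IsFiniteMeasure P] (hm : 𝓖 ≤ m₀)
    {e ε : Ω → ℝ} {E S : Set Ω} {s lo hi : ℝ} (hs : 0 < s) (hE : LikelyGiven 𝓖 P (s ^ 2) E)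
    (hS : MeasurableSet[𝓖] S) (he0 : ∀ ω, 0 ≤ e ω) (he : Integrable (fun ω => e ω ^ 2) P)
    (hε : Measurable[𝓖] ε) (hlo : 0 < lo) (hεlo : ∀ᵐ ω ∂P, lo ≤ ε ω)
    (hεhi : ∀ᵐ ω ∂P, ε ω ≤ hi) (hvar : ∀ᵐ ω ∂P, (P[fun ω => e ω ^ 2 | 𝓖]) ω ≤ ε ω ^ 2) :
    Integrable (Eᶜ.indicator e) P ∧
      ∫ ω in S, Eᶜ.indicator e ω ∂P ≤ s * ∫ ω in S, ε ω ∂P := by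
  have hem : AEStronglyMeasurable e P := by
    have h1 : e = fun ω => √(e ω ^ 2) := funext fun ω => (Real.sqrt_sq (he0 ω)).symm
    rw [h1]
    exact Real.continuous_sqrt.comp_aestronglyMeasurable he.1
  have hei : Integrable e P := by
    refine ((integrable_const (1 : ℝ)).add he).mono' hem (Eventually.of_forall fun ω => ?_)
    rw [Real.norm_of_nonneg (he0 ω)]
    simp only [Pi.add_apply]
    nlinarith [sq_nonneg (e ω - 1)]
  have hεm : AEStronglyMeasurable ε P := (hε.mono hm le_rfl).aestronglyMeasurable
  have hεi : Integrable ε P := Integrable.of_bound hεm hi (by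
    filter_upwards [hεlo, hεhi] with ω h1 h2
    rwa [Real.norm_of_nonneg (by linarith)])
  have hε2 : Integrable (fun ω => ε ω ^ 2) P :=
    Integrable.of_bound (hεm.pow 2) (hi ^ 2) (by
      filter_upwards [hεlo, hεhi] with ω h1 h2
      rw [Real.norm_of_nonneg (sq_nonneg _)]
      exact pow_le_pow_left₀ (by linarith) h2 2)
  have hSm := hm _ hS
  have hEm := hE.1
  refine ⟨hei.indicator₀ hEm.compl, ?_⟩
  -- the weight of the second moment
  set w : Ω → ℝ := S.indicator fun ω => s / 2 / ε ω with hw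
  have hwm : StronglyMeasurable[𝓖] w :=
    ((measurable_const.div hε).indicator hS).stronglyMeasurable
  have hw0 : ∀ᵐ ω ∂P, 0 ≤ w ω := by
    filter_upwards [hεlo] with ω h1
    have h2 : 0 < ε ω := by linarith
    exact Set.indicator_apply_nonneg fun _ => by positivity
  have hwB : ∀ᵐ ω ∂P, w ω ≤ s / 2 / lo := by
    filter_upwards [hεlo] with ω h1
    refine Set.indicator_apply_le' (fun _ => by gcongr) fun _ => by positivity
  have h1 := integral_mul_le_of_condExp_le hm hwm hw0 hwB he hε2 hvar
  have h2 : ∫ ω, w ω * ε ω ^ 2 ∂P = s / 2 * ∫ ω in S, ε ω ∂P := by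
    rw [← integral_indicator hSm, ← integral_const_mul]
    refine integral_congr_ae ?_
    filter_upwards [hεlo] with ω h3
    have h4 : ε ω ≠ 0 := by linarith
    by_cases h5 : ω ∈ S
    · simp only [hw, Set.indicator_of_mem h5]; field_simp
    · simp [hw, h5]
  have h3 := hE.2 (S.indicator ε) (hε.indicator hS).stronglyMeasurable
    (by filter_upwards [hεlo] with ω h3
        exact Set.indicator_apply_nonneg fun _ => (by linarith))
    ⟨max hi 0, by
      filter_upwards [hεhi] with ω h3
      exact Set.indicator_apply_le' (fun _ => h3.trans (le_max_left _ _))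
        fun _ => le_max_right _ _⟩
  rw [integral_indicator hSm] at h3
  have hwe : Integrable (fun ω => w ω * e ω ^ 2) P := he.bdd_mul (c := s / 2 / lo)
    (hwm.mono hm).aestronglyMeasurable (by
      filter_upwards [hw0, hwB] with ω h1 h2
      rwa [Real.norm_of_nonneg h1])
  have hEε : Integrable (Eᶜ.indicator (S.indicator ε)) P :=
    (hεi.indicator hSm).indicator₀ hEm.compl
  -- Young's inequality e ≤ s e²/(2ε) + ε/(2s) off `E`. The second-moment bound controls the first
  -- term, and the failure probability s² the second; each contributes s/2 times the integral of ε.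
  have h4 : ∫ ω in S, Eᶜ.indicator e ω ∂P ≤
      ∫ ω, (w ω * e ω ^ 2 + 1 / (2 * s) * Eᶜ.indicator (S.indicator ε) ω) ∂P := by
    rw [← integral_indicator hSm]
    refine integral_mono_ae ((hei.indicator₀ hEm.compl).indicator hSm)
      (hwe.add (hEε.const_mul _)) ?_
    filter_upwards [hεlo] with ω h5
    have hε0 : 0 < ε ω := by linarith
    by_cases h6 : ω ∈ S
    · by_cases h7 : ω ∈ E
      · simp only [hw, Set.indicator_of_mem h6,
          Set.indicator_of_notMem (show ω ∉ Eᶜ from fun h => h h7)]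
        positivity
      · simp only [hw, Set.indicator_of_mem h6, Set.indicator_of_mem (show ω ∈ Eᶜ from h7)]
        have h8 : s / 2 / ε ω * e ω ^ 2 + 1 / (2 * s) * ε ω - e ω =
            (s * e ω - ε ω) ^ 2 / (2 * s * ε ω) := by field_simp; ring
        have h9 : 0 ≤ (s * e ω - ε ω) ^ 2 / (2 * s * ε ω) := by positivity
        linarith
    · simp only [hw, Set.indicator_of_notMem h6, zero_mul, zero_add]
      exact mul_nonneg (by positivity) (Set.indicator_nonneg
        (fun _ _ => (Set.indicator_of_notMem h6 ε).ge) ω)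
  rw [integral_add hwe (hEε.const_mul _), integral_const_mul] at h4
  have h5 : 1 / (2 * s) * ∫ ω, Eᶜ.indicator (S.indicator ε) ω ∂P ≤
      1 / (2 * s) * (s ^ 2 * ∫ ω in S, ε ω ∂P) := by gcongr
  have h6 : 1 / (2 * s) * (s ^ 2 * ∫ ω in S, ε ω ∂P) = s / 2 * ∫ ω in S, ε ω ∂P := by
    field_simp
  linarith

/-- Telescoping of a drift inequality with gains `W`, costs `e` and noise `n`. -/
lemma summable_integral_of_drift [IsProbabilityMeasure P] {S : ℕ → Set Ω} (hS : Antitone S)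
    (hSm : ∀ k, MeasurableSet (S k)) {Φ W n e : ℕ → Ω → ℝ} {N : ℝ}
    (hN : ∀ᵐ ω ∂P, Φ 0 ω ≤ N) (hΦ : ∀ k, ∀ᵐ ω ∂P, 0 ≤ Φ k ω)
    (hW : ∀ k, Integrable (W k) P) (hW0 : ∀ k, ∀ᵐ ω ∂P, 0 ≤ W k ω)
    (hn : ∀ k, Integrable (n k) P) (hn0 : ∀ k, ∀ᵐ ω ∂P, 0 ≤ n k ω)
    (he : ∀ k, Integrable (e k) P) (he0 : ∀ k, ∀ᵐ ω ∂P, 0 ≤ e k ω)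
    (hne : ∀ k, ∫ ω in S k, n k ω ∂P ≤ ∫ ω in S k, e k ω ∂P)
    (hstep : ∀ k, ∀ᵐ ω ∂P, ω ∈ S k → Φ (k + 1) ω + W k ω + e k ω ≤ Φ k ω + n k ω) :
    Summable fun k => ∫ ω in S k, W k ω ∂P := by
  have conv : ∀ (A : Set Ω) (X : Ω → ℝ), Integrable X P → (∀ᵐ ω ∂P, 0 ≤ X ω) →
      ∫⁻ ω in A, ENNReal.ofReal (X ω) ∂P = ENNReal.ofReal (∫ ω in A, X ω ∂P) := fun A X h1 h2 =>
    (ofReal_integral_eq_lintegral_ofReal h1.integrableOn (ae_restrict_of_ae h2)).symm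
  set a : ℕ → ENNReal := fun k => ∫⁻ ω in S k, ENNReal.ofReal (Φ k ω) ∂P with ha
  set w : ℕ → ENNReal := fun k => ∫⁻ ω in S k, ENNReal.ofReal (W k ω) ∂P with hw
  -- Extended nonnegative integrals avoid any measurability or integrability of `Φ`. Only the
  -- integral of the cost `e` has to be finite, so that it can be cancelled. Restricting to the
  -- smaller next event is free because `Φ` is nonnegative.
  have hdesc : ∀ k, a (k + 1) + w k ≤ a k := by
    intro k
    have h1 : a (k + 1) ≤ ∫⁻ ω in S k, ENNReal.ofReal (Φ (k + 1) ω) ∂P :=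
      lintegral_mono_set (hS (Nat.le_succ k))
    have hfin : ∫⁻ ω in S k, ENNReal.ofReal (e k ω) ∂P ≠ ⊤ := by
      rw [conv _ _ (he k) (he0 k)]; exact ENNReal.ofReal_ne_top
    refine (ENNReal.add_le_add_iff_right hfin).1 ?_
    calc a (k + 1) + w k + ∫⁻ ω in S k, ENNReal.ofReal (e k ω) ∂P
        ≤ ∫⁻ ω in S k, ENNReal.ofReal (Φ (k + 1) ω) ∂P + w k +
            ∫⁻ ω in S k, ENNReal.ofReal (e k ω) ∂P := by gcongr
      _ ≤ ∫⁻ ω in S k, (ENNReal.ofReal (Φ (k + 1) ω) + ENNReal.ofReal (W k ω) +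
            ENNReal.ofReal (e k ω)) ∂P :=
          (add_le_add_left (le_lintegral_add _ _) _).trans (le_lintegral_add _ _)
      _ ≤ ∫⁻ ω in S k, (ENNReal.ofReal (Φ k ω) + ENNReal.ofReal (n k ω)) ∂P := by
          refine lintegral_mono_ae ?_
          filter_upwards [ae_restrict_of_ae (hstep k), ae_restrict_mem (hSm k),
            ae_restrict_of_ae (hΦ k), ae_restrict_of_ae (hΦ (k + 1)),
            ae_restrict_of_ae (hW0 k), ae_restrict_of_ae (hn0 k),
            ae_restrict_of_ae (he0 k)] with ω b1 b2 b3 b4 b5 b6 b7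
          rw [← ENNReal.ofReal_add b4 b5, ← ENNReal.ofReal_add (add_nonneg b4 b5) b7,
            ← ENNReal.ofReal_add b3 b6]
          exact ENNReal.ofReal_le_ofReal (b1 b2)
      _ = a k + ∫⁻ ω in S k, ENNReal.ofReal (n k ω) ∂P :=
          lintegral_add_right' _ (hn k).aemeasurable.ennreal_ofReal.restrict
      _ ≤ a k + ∫⁻ ω in S k, ENNReal.ofReal (e k ω) ∂P := by
          rw [conv _ _ (hn k) (hn0 k), conv _ _ (he k) (he0 k)]
          exact add_le_add_right (ENNReal.ofReal_le_ofReal (hne k)) _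
  have hsum : ∀ j, a j + ∑ k ∈ Finset.range j, w k ≤ a 0 := by
    intro j
    induction j with
    | zero => simp
    | succ j ih =>
      rw [Finset.sum_range_succ, add_comm (∑ k ∈ Finset.range j, w k), ← add_assoc]
      exact (add_le_add_left (hdesc j) _).trans ih
  have ha0 : a 0 ≤ ENNReal.ofReal N := by
    calc a 0 ≤ ∫⁻ _ in S 0, ENNReal.ofReal N ∂P := by
          refine lintegral_mono_ae ?_
          filter_upwards [ae_restrict_of_ae hN] with ω h1
          exact ENNReal.ofReal_le_ofReal h1
      _ = ENNReal.ofReal N * P (S 0) := setLIntegral_const _ _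
      _ ≤ ENNReal.ofReal N := mul_le_of_le_one_right' prob_le_one
  have htsum : ∑' k, w k ≠ ⊤ := by
    refine ne_top_of_le_ne_top (ENNReal.ofReal_ne_top (r := N)) ?_
    exact ENNReal.tsum_le_of_sum_range_le fun j =>
      (le_add_self.trans (hsum j)).trans ha0
  refine (ENNReal.summable_toReal htsum).congr fun k => ?_
  change (∫⁻ ω in S k, ENNReal.ofReal (W k ω) ∂P).toReal = _
  rw [conv _ _ (hW k) (hW0 k), ENNReal.toReal_ofReal]
  exact setIntegral_nonneg_of_ae (hW0 k)

/-- Summability of expectations implies summability almost everywhere. -/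
lemma ae_summable_of_summable_integral {S : ℕ → Set Ω}
    (hSm : ∀ k, MeasurableSet (S k)) {W : ℕ → Ω → ℝ}
    (hW : ∀ k, Integrable (W k) P) (hW0 : ∀ k, ∀ᵐ ω ∂P, 0 ≤ W k ω)
    (hsum : Summable fun k => ∫ ω in S k, W k ω ∂P) :
    ∀ᵐ ω ∂P, (∀ k, ω ∈ S k) → Summable fun k => W k ω := by
  have h1 : ∫⁻ ω, ∑' k, (S k).indicator (fun ω => ENNReal.ofReal (W k ω)) ω ∂P ≠ ⊤ := by
    rw [lintegral_tsum fun k => (hW k).aemeasurable.ennreal_ofReal.indicator (hSm k)]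
    have h2 : ∀ k, ∫⁻ ω, (S k).indicator (fun ω => ENNReal.ofReal (W k ω)) ω ∂P =
        ENNReal.ofReal (∫ ω in S k, W k ω ∂P) := fun k => by
      rw [lintegral_indicator (hSm k)]
      exact (ofReal_integral_eq_lintegral_ofReal (hW k).integrableOn
        (ae_restrict_of_ae (hW0 k))).symm
    simp_rw [h2]
    exact hsum.tsum_ofReal_ne_top
  have h3 := ae_lt_top' (AEMeasurable.tsum fun k =>
    (hW k).aemeasurable.ennreal_ofReal.indicator (hSm k)) h1
  filter_upwards [h3, ae_all_iff.2 hW0] with ω h4 h5 h6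
  refine (ENNReal.summable_toReal h4.ne).congr fun k => ?_
  rw [Set.indicator_of_mem (h6 k), ENNReal.toReal_ofReal (h5 k)]

/-- A sequence of bounded quantities whose parts on likely events are summable in expectation is
itself summable in expectation. -/
lemma summable_integral_of_likely [IsProbabilityMeasure P] {ℱ : ℕ → MeasurableSpace Ω}
    (hℱ : ∀ k, ℱ k ≤ m₀) {C : ℕ → Set Ω} (hC : Antitone C)
    (hCm : ∀ k, MeasurableSet[ℱ k] (C k)) {D : ℕ → Ω → ℝ} {B : ℝ}
    (hD : ∀ k, Measurable[ℱ k] (D k)) (hD0 : ∀ k, ∀ᵐ ω ∂P, 0 ≤ D k ω)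
    (hDB : ∀ k, ∀ᵐ ω ∂P, D k ω ≤ B) {E : ℕ → Set Ω} {p : ℝ} (hp : p < 1)
    (hE : ∀ k, LikelyGiven (ℱ k) P p (E k))
    (hsum : Summable fun k => ∫ ω in C (k + 1), (E k).indicator (D k) ω ∂P) :
    Summable fun k => ∫ ω in C k, D k ω ∂P := by
  have hCm' := fun k => hℱ k _ (hCm k)
  have hDi : ∀ k, Integrable (D k) P := fun k =>
    Integrable.of_bound ((hD k).mono (hℱ k) le_rfl).aestronglyMeasurable B (by
      filter_upwards [hD0 k, hDB k] with ω h1 h2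
      rwa [Real.norm_of_nonneg h1])
  have hB : 0 ≤ B := by
    obtain ⟨ω, h1, h2⟩ := ((hD0 0).and (hDB 0)).exists
    exact h1.trans h2
  -- The hypothesis concerns `C (k + 1)`, whereas likelihood given `ℱ k` can be used only on `C k`.
  -- The probabilities of the differences telescope, so the discrepancy is summable.
  have htel : Summable fun k => P.real (C k) - P.real (C (k + 1)) := by
    refine summable_of_sum_range_le (c := P.real (C 0))
      (fun k => sub_nonneg.2 (measureReal_mono (hC (Nat.le_succ k)))) fun j => ?_
    rw [Finset.sum_range_sub' fun k => P.real (C k)]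
    linarith [measureReal_nonneg (μ := P) (s := C j)]
  have hle : ∀ k, ∫ ω in C k, D k ω ∂P ≤ (1 - p)⁻¹ *
      (∫ ω in C (k + 1), (E k).indicator (D k) ω ∂P +
        B * (P.real (C k) - P.real (C (k + 1)))) := by
    intro k
    have hEm := (hE k).1
    have hEi := (hDi k).indicator₀ hEm
    have hEci := (hDi k).indicator₀ hEm.compl
    have h1 := (hE k).2 ((C k).indicator (D k)) ((hD k).indicator (hCm k)).stronglyMeasurable
      (by filter_upwards [hD0 k] with ω h; exact Set.indicator_apply_nonneg fun _ => h)
      ⟨B, by filter_upwards [hDB k] with ω h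
             exact Set.indicator_apply_le' (fun _ => h) fun _ => hB⟩
    rw [Set.indicator_indicator, Set.inter_comm, ← Set.indicator_indicator,
      integral_indicator (hCm' k), integral_indicator (hCm' k)] at h1
    have h2 : ∫ ω in C k, D k ω ∂P =
        ∫ ω in C k, (E k).indicator (D k) ω ∂P + ∫ ω in C k, (E k)ᶜ.indicator (D k) ω ∂P := by
      rw [← integral_add hEi.integrableOn hEci.integrableOn]
      simp_rw [Set.indicator_self_add_compl_apply]
    have h3 : ∫ ω in C k, (E k).indicator (D k) ω ∂P =
        ∫ ω in C (k + 1), (E k).indicator (D k) ω ∂P +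
          ∫ ω in C k \ C (k + 1), (E k).indicator (D k) ω ∂P := by
      rw [← setIntegral_union Set.disjoint_sdiff_right ((hCm' k).diff (hCm' (k + 1)))
        hEi.integrableOn hEi.integrableOn, Set.union_sdiff_cancel (hC (Nat.le_succ k))]
    have h4 : ∫ ω in C k \ C (k + 1), (E k).indicator (D k) ω ∂P ≤
        B * (P.real (C k) - P.real (C (k + 1))) := by
      rw [← measureReal_sdiff (hC (Nat.le_succ k)) (hCm' (k + 1)), mul_comm, ← smul_eq_mul,
        ← setIntegral_const]
      refine integral_mono_ae hEi.integrableOn (integrable_const _) (ae_restrict_of_ae ?_)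
      filter_upwards [hDB k] with ω h
      exact Set.indicator_apply_le' (fun _ => h) fun _ => hB
    rw [inv_mul_eq_div, le_div_iff₀ (by linarith)]
    linarith
  exact Summable.of_nonneg_of_le (fun k => setIntegral_nonneg_of_ae (hD0 k)) hle
    ((hsum.add (htel.mul_left B)).mul_left _)

end Probability

/-- A positive adapted sequence that contracts on likely events and cannot grow too fast
otherwise leaves every region in which this behaviour is guaranteed. -/
lemma ae_exists_notMem_of_contraction {Ω : Type*} {m₀ : MeasurableSpace Ω} {P : Measure Ω}
    [IsProbabilityMeasure P] {ℱ : ℕ → MeasurableSpace Ω} (hℱ : ∀ k, ℱ k ≤ m₀)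
    {R : ℕ → Set Ω} (hR : Antitone R) (hRm : ∀ k, MeasurableSet[ℱ k] (R k)) {Y : ℕ → Ω → ℝ}
    (hY : ∀ k, Measurable[ℱ k] (Y k)) {lo : ℝ} (hlo : 0 < lo) (hYlo : ∀ k, ∀ᵐ ω ∂P, lo ≤ Y k ω)
    {B : ℕ → ℝ} (hYB : ∀ k, ∀ᵐ ω ∂P, Y k ω ≤ B k) {E : ℕ → Set Ω} {p γ : ℝ}
    (hE : ∀ k, LikelyGiven (ℱ k) P p (E k)) (hγ : 0 < γ) (hγp : γ⁻¹ + γ * p < 1)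
    (hstep : ∀ k, ∀ᵐ ω ∂P, ω ∈ R (k + 1) →
      Y (k + 1) ω ≤ γ * Y k ω ∧ (ω ∈ E k → Y (k + 1) ω ≤ γ⁻¹ * Y k ω)) :
    ∀ᵐ ω ∂P, ∃ k, ω ∉ R k := by
  have hRm' := fun k => hℱ k _ (hRm k)
  have hYi : ∀ k, Integrable (Y k) P := fun k =>
    Integrable.of_bound ((hY k).mono (hℱ k) le_rfl).aestronglyMeasurable (B k) (by
      filter_upwards [hYlo k, hYB k] with ω h1 h2
      rwa [Real.norm_of_nonneg (hlo.le.trans h1)])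
  set a : ℕ → ℝ := fun k => ∫ ω in R k, Y k ω ∂P with ha
  have ha0 : ∀ k, 0 ≤ a k := fun k => setIntegral_nonneg_of_ae (by
    filter_upwards [hYlo k] with ω h using hlo.le.trans h)
  -- The factor is γ⁻¹ on the likely event and at most γ off it. The maximum with 0 keeps powers of
  -- the ratio monotone, as no sign of `p` is assumed.
  have hcontr : ∀ k, a (k + 1) ≤ max (γ⁻¹ + γ * p) 0 * a k := by
    intro k
    have hEm := (hE k).1
    have hEc := (hYi k).indicator₀ hEm.compl
    have hi : Integrable (fun ω => γ⁻¹ * Y k ω + γ * (E k)ᶜ.indicator (Y k) ω) P :=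
      ((hYi k).const_mul _).add (hEc.const_mul _)
    have h1 : a (k + 1) ≤
        ∫ ω in R (k + 1), (γ⁻¹ * Y k ω + γ * (E k)ᶜ.indicator (Y k) ω) ∂P := by
      refine integral_mono_ae (hYi (k + 1)).integrableOn hi.integrableOn ?_
      filter_upwards [ae_restrict_of_ae (hstep k), ae_restrict_mem (hRm' (k + 1)),
        ae_restrict_of_ae (hYlo k)] with ω b1 b2 b3
      by_cases hω : ω ∈ E k
      · rw [Set.indicator_of_notMem (Set.notMem_compl_iff.2 hω), mul_zero, add_zero]
        exact (b1 b2).2 hω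
      · rw [Set.indicator_of_mem hω]
        have : 0 ≤ γ⁻¹ * Y k ω := mul_nonneg (inv_nonneg.2 hγ.le) (hlo.le.trans b3)
        linarith [(b1 b2).1]
    have h2 : ∫ ω in R (k + 1), (γ⁻¹ * Y k ω + γ * (E k)ᶜ.indicator (Y k) ω) ∂P ≤
        ∫ ω in R k, (γ⁻¹ * Y k ω + γ * (E k)ᶜ.indicator (Y k) ω) ∂P := by
      refine setIntegral_mono_set hi.integrableOn (ae_restrict_of_ae ?_)
        (Eventually.of_forall (hR (Nat.le_succ k)))
      filter_upwards [hYlo k] with ω h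
      have hY0 := hlo.le.trans h
      exact add_nonneg (mul_nonneg (inv_nonneg.2 hγ.le) hY0)
        (mul_nonneg hγ.le (Set.indicator_apply_nonneg fun _ => hY0))
    replace h2 := h1.trans h2
    rw [integral_add ((hYi k).const_mul _).integrableOn (hEc.const_mul _).integrableOn,
      integral_const_mul, integral_const_mul] at h2
    have h3 := (hE k).2 ((R k).indicator (Y k)) ((hY k).indicator (hRm k)).stronglyMeasurable
      (by filter_upwards [hYlo k] with ω h
          exact Set.indicator_apply_nonneg fun _ => hlo.le.trans h)
      ⟨B k, by filter_upwards [hYlo k, hYB k] with ω h h'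
               exact Set.indicator_apply_le' (fun _ => h') fun _ => hlo.le.trans (h.trans h')⟩
    rw [Set.indicator_indicator, Set.inter_comm, ← Set.indicator_indicator,
      integral_indicator (hRm' k), integral_indicator (hRm' k)] at h3
    have h4 := mul_le_mul_of_nonneg_left h3 hγ.le
    have h5 : (γ⁻¹ + γ * p) * a k ≤ max (γ⁻¹ + γ * p) 0 * a k :=
      mul_le_mul_of_nonneg_right (le_max_left _ _) (ha0 k)
    have h6 : a k = ∫ ω in R k, Y k ω ∂P := rfl
    rw [← h6] at h2 h4
    linarith
  have hgeom : ∀ k, a k ≤ max (γ⁻¹ + γ * p) 0 ^ k * a 0 := by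
    intro k
    induction k with
    | zero => simp
    | succ k ih =>
      refine (hcontr k).trans ?_
      rw [pow_succ', mul_assoc]
      exact mul_le_mul_of_nonneg_left ih (le_max_right _ _)
  have hlim : Tendsto (fun k => max (γ⁻¹ + γ * p) 0 ^ k * a 0) atTop (𝓝 0) := by
    have := (tendsto_pow_atTop_nhds_zero_of_lt_one (le_max_right (γ⁻¹ + γ * p) 0)
      (max_lt hγp zero_lt_one)).mul_const (a 0)
    rwa [zero_mul] at this
  have hprob : ∀ k, lo * P.real (⋂ k, R k) ≤ max (γ⁻¹ + γ * p) 0 ^ k * a 0 := by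
    intro k
    refine le_trans ?_ (hgeom k)
    calc lo * P.real (⋂ k, R k) ≤ lo * P.real (R k) := by
          refine mul_le_mul_of_nonneg_left (measureReal_mono (Set.iInter_subset _ k)) hlo.le
      _ = ∫ _ in R k, lo ∂P := by rw [setIntegral_const, smul_eq_mul, mul_comm]
      _ ≤ a k := integral_mono_ae (integrable_const _) (hYi k).integrableOn
          (ae_restrict_of_ae (hYlo k))
  have hzero : P.real (⋂ k, R k) = 0 := by
    have h1 : lo * P.real (⋂ k, R k) ≤ 0 :=
      ge_of_tendsto' hlim hprob
    have h2 := measureReal_nonneg (μ := P) (s := ⋂ k, R k)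
    nlinarith
  rw [measureReal_eq_zero_iff] at hzero
  refine (measure_eq_zero_iff_ae_notMem.1 hzero).mono fun ω h => ?_
  simpa using h

/-! ### The random process -/

section Adapted

variable {d m : ℕ} {p : Problem d m} {q : Params} {K : Constants} {O : Set (Vec d)} {ν : ℝ}
  {x₀ : Vec d} {Ω : Type*} {T : Ω → ℕ → Iteration d m}

/-- Up to iteration `k`, the merit parameter has not changed since iteration `k₀`, where it was
at most `μhat`. -/
def stableEvent (K : Constants) (T : Ω → ℕ → Iteration d m) (k₀ k : ℕ) : Set Ω :=
  {ω | (T ω k₀).μ ≤ K.μhat ∧ ∀ j, k₀ ≤ j → j < k → (T ω j).μ = (T ω k₀).μ}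

lemma stableEvent_antitone (k₀ : ℕ) : Antitone (stableEvent K T k₀) :=
  fun _ _ h _ hω => ⟨hω.1, fun j h1 h2 => hω.2 j h1 (h2.trans_le h)⟩

/-- The estimates of function values in iteration `k` are accurate. -/
def valueEvent (p : Problem d m) (q : Params) (T : Ω → ℕ → Iteration d m) (k : ℕ) :
    Set Ω :=
  {ω | (T ω k).ValueAccurate p q} ∩ {ω | (T ω k).SocValueAccurate p q}

/-- All estimates in iteration `k` are accurate. -/
def accurateEvent (p : Problem d m) (q : Params) (T : Ω → ℕ → Iteration d m)
    (k : ℕ) : Set Ω :=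
  valueEvent p q T k ∩ {ω | (T ω k).ModelAccurate p q}

variable [mΩ : MeasurableSpace Ω] {P : Measure Ω} {ℱ 𝒢 : ℕ → MeasurableSpace Ω}

namespace IsRandomModel

lemma half_mono (h : IsRandomModel p q P ℱ 𝒢 T) : Monotone 𝒢 :=
  monotone_nat_of_le_succ fun k => (h.half_le k).trans (h.le_half (k + 1))

lemma mono (h : IsRandomModel p q P ℱ 𝒢 T) : Monotone ℱ :=
  monotone_nat_of_le_succ fun k => (h.le_half k).trans (h.half_le k)

lemma half_le_total (h : IsRandomModel p q P ℱ 𝒢 T) (k : ℕ) : 𝒢 k ≤ mΩ :=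
  (h.half_le k).trans (h.le_total (k + 1))

/-- The merit parameter of iteration `k` is selected before function values are drawn, so the value
errors can still be conditioned on this event. -/
lemma measurableSet_stableEvent (h : IsRandomModel p q P ℱ 𝒢 T) {k₀ k : ℕ}
    (hk : k₀ ≤ k) : MeasurableSet[𝒢 k] (stableEvent K T k₀ (k + 1)) := by
  have hμ : ∀ j ≤ k, Measurable[𝒢 k] fun ω => (T ω j).μ := fun j hj =>
    (h.meas_μ j).mono (h.half_mono hj) le_rfl
  have heq : stableEvent K T k₀ (k + 1) = {ω | (T ω k₀).μ ≤ K.μhat} ∩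
      ⋂ j : ℕ, ⋂ _ : k₀ ≤ j, ⋂ _ : j < k + 1, {ω | (T ω j).μ = (T ω k₀).μ} := by
    ext ω; simp [stableEvent]
  rw [heq]
  refine MeasurableSet.inter (hμ k₀ hk measurableSet_Iic) (MeasurableSet.iInter fun j =>
    MeasurableSet.iInter fun _ => MeasurableSet.iInter fun hj => ?_)
  exact measurableSet_eq_fun (hμ j (Nat.lt_succ_iff.1 hj)) (hμ k₀ hk)

/-- The strict inequality matters: the reference merit parameter is selected during iteration `k₀`,
and `ℱ k₀` need not contain it. -/
lemma measurableSet_stableEvent' (h : IsRandomModel p q P ℱ 𝒢 T) {k₀ k : ℕ}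
    (hk : k₀ < k) : MeasurableSet[ℱ k] (stableEvent K T k₀ k) := by
  obtain ⟨j, rfl⟩ := Nat.exists_eq_add_one.2 (Nat.zero_lt_of_lt hk)
  exact h.half_le j _ (h.measurableSet_stableEvent (Nat.lt_succ_iff.1 hk))

variable [IsProbabilityMeasure P]

lemma likely_valueEvent (h : IsRandomModel p q P ℱ 𝒢 T) (hq : q.Valid) (k : ℕ) :
    LikelyGiven (𝒢 k) P (q.pf + q.pf) (valueEvent p q T k) :=
  (LikelyGiven.of_condExp (h.half_le_total k) hq.pf_mem.2 (h.value_prob k)).inter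
    (h.half_le_total k) (LikelyGiven.of_condExp (h.half_le_total k) hq.pf_mem.2 (h.soc_prob k))

/-- Union bound after coarsening the value events from `𝒢 k` to `ℱ k`. For α = 0 the Hessian
condition is void, and its allowance `ph` is merely added. -/
lemma likely_accurateEvent (h : IsRandomModel p q P ℱ 𝒢 T) (hq : q.Valid) (k : ℕ) :
    LikelyGiven (ℱ k) P (q.ph + q.pg + 2 * q.pf) (accurateEvent p q T k) := by
  have h1 : LikelyGiven (ℱ k) P q.ph {ω | q.α = 1 → (T ω k).HessAccurate p q} := by
    by_cases hα : q.α = 1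
    · simpa only [hα, true_imp_iff] using
        LikelyGiven.of_condExp (h.le_total k) hq.ph_mem.2 (h.hess_prob hα k)
    · simpa only [hα, false_imp_iff, Set.ofPred_true] using LikelyGiven.univ hq.ph_mem.1.le
  have h2 := ((h.likely_valueEvent hq k).mono (h.le_half k)).inter (h.le_total k)
    (h1.inter (h.le_total k)
      (LikelyGiven.of_condExp (h.le_total k) hq.pg_mem.2 (h.grad_prob k)))
  rw [show q.ph + q.pg + 2 * q.pf = q.pf + q.pf + (q.ph + q.pg) by ring]
  exact h2

end IsRandomModel

variable [IsProbabilityMeasure P]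

/-- This is the source of the square and of the 16 in the probability condition: two errors, each
costing ν√(2 p_f) times ε, must not exceed the decay of ε. -/
lemma sqrt_two_pf_le (hq : q.Valid) (hν : ν ∈ Set.Ioo (0 : ℝ) 1)
    (hprob : q.ph + q.pg + 2 * q.pf ≤ (1 - ν) ^ 2 / (16 * ν ^ 2) * (1 - 1 / q.γ) ^ 2) :
    ν * (2 * √(q.pf + q.pf)) ≤ decayRate q ν := by
  have h1 : 1 / q.γ < 1 := (div_lt_one (by linarith [hq.one_lt_γ])).2 hq.one_lt_γ
  have hν0 := hν.1
  have h2 : 0 ≤ (1 - ν) / (4 * ν) * (1 - 1 / q.γ) :=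
    mul_nonneg (div_nonneg (by linarith [hν.2]) (by linarith)) (by linarith)
  have h3 : √(q.pf + q.pf) ≤ (1 - ν) / (4 * ν) * (1 - 1 / q.γ) := by
    refine Real.sqrt_le_iff.2 ⟨h2, ?_⟩
    have : ((1 - ν) / (4 * ν) * (1 - 1 / q.γ)) ^ 2 =
        (1 - ν) ^ 2 / (16 * ν ^ 2) * (1 - 1 / q.γ) ^ 2 := by
      rw [mul_pow, div_pow, mul_pow]; norm_num
    rw [this]
    linarith [hq.ph_mem.1, hq.pg_mem.1]
  calc ν * (2 * √(q.pf + q.pf)) ≤ ν * (2 * ((1 - ν) / (4 * ν) * (1 - 1 / q.γ))) := by gcongr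
    _ = decayRate q ν := by rw [decayRate]; field_simp; ring

/-- The failure probability is small compared to the growth of the radius. -/
lemma failure_prob_lt (hq : q.Valid) (hreg : Regularity p K O) (hν : WeightCond m q K ν)
    (hprob : q.ph + q.pg + 2 * q.pf ≤ (1 - ν) ^ 2 / (16 * ν ^ 2) * (1 - 1 / q.γ) ^ 2) :
    q.γ⁻¹ + q.γ * (q.ph + q.pg + 2 * q.pf) < 1 := by
  have hγ := hq.one_lt_γ
  have hγ0 : 0 < q.γ := by linarith
  have hν0 := hν.1.1
  have h1ν : 0 < 1 - ν := by linarith [hν.1.2]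
  -- The weight condition makes 1 - ν so small that γ times the failure probability is at most (1 -
  -- γ⁻¹)²/16, hence below 1 - γ⁻¹.
  have h1 : (1 - ν) / ν ≤ q.γ⁻¹ := by
    rw [div_le_iff₀ hν0, inv_mul_eq_div, le_div_iff₀ hγ0]
    have h2 := hν.radius_le hq hreg
    have h3 : ν * (q.η ^ 3 * q.κfcd) ≤ ν * 1 := by
      refine mul_le_mul_of_nonneg_left (mul_le_one₀ (pow_le_one₀ hq.η_mem.1.le hq.η_mem.2.le)
        hq.κfcd_mem.1.le hq.κfcd_mem.2) hν0.le
    have h4 : q.γ ≤ 4 * q.γ ^ 3 * max 1 q.Δmax := by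
      have h5 : q.γ ≤ q.γ ^ 3 := le_self_pow₀ hγ.le (by norm_num)
      have h6 : 4 * q.γ ^ 3 ≤ 4 * q.γ ^ 3 * max 1 q.Δmax :=
        le_mul_of_one_le_right (by positivity) (le_max_left _ _)
      linarith
    have := mul_le_mul_of_nonneg_right h4 h1ν.le
    linarith
  have h2 : (1 - ν) ^ 2 / (16 * ν ^ 2) ≤ q.γ⁻¹ / 16 := by
    have h3 : ((1 - ν) / ν) ^ 2 ≤ q.γ⁻¹ := by
      have h4 : ((1 - ν) / ν) ^ 2 ≤ q.γ⁻¹ ^ 2 := pow_le_pow_left₀ (by positivity) h1 2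
      have h5 : q.γ⁻¹ ^ 2 ≤ q.γ⁻¹ :=
        pow_le_of_le_one (inv_nonneg.2 hγ0.le) (inv_le_one_of_one_le₀ hγ.le) two_ne_zero
      exact h4.trans h5
    calc (1 - ν) ^ 2 / (16 * ν ^ 2) = ((1 - ν) / ν) ^ 2 / 16 := by field_simp
      _ ≤ _ := by gcongr
  have h3 : q.γ⁻¹ < 1 := inv_lt_one_of_one_lt₀ hγ
  have h4 : 0 < q.γ⁻¹ := inv_pos.2 hγ0
  rw [one_div] at hprob
  have h5 : q.ph + q.pg + 2 * q.pf ≤ q.γ⁻¹ / 16 * (1 - q.γ⁻¹) ^ 2 :=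
    hprob.trans (by gcongr)
  have h6 := mul_le_mul_of_nonneg_left h5 hγ0.le
  have h7 : q.γ * (q.γ⁻¹ / 16 * (1 - q.γ⁻¹) ^ 2) = (1 - q.γ⁻¹) ^ 2 / 16 := by
    field_simp
  nlinarith

/-- The expected noise is outweighed by the decrease of the reliability parameter. -/
lemma integral_noise_le (hq : q.Valid) (hrun : ∀ᵐ ω ∂P, IsRun p q x₀ (T ω))
    (hmodel : IsRandomModel p q P ℱ 𝒢 T) (hν : ν ∈ Set.Ioo (0 : ℝ) 1)
    (hprob : q.ph + q.pg + 2 * q.pf ≤ (1 - ν) ^ 2 / (16 * ν ^ 2) * (1 - 1 / q.γ) ^ 2)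
    {k : ℕ} {S : Set Ω} (hS : MeasurableSet[𝒢 k] S) :
    Integrable (fun ω => ν * ((valueEvent p q T k)ᶜ.indicator (fun ω => (T ω k).errX p q) ω +
      (valueEvent p q T k)ᶜ.indicator (fun ω => (T ω k).errFinal p q) ω)) P ∧
    Integrable (fun ω => decayRate q ν * (T ω k).ε) P ∧
    ∫ ω in S, ν * ((valueEvent p q T k)ᶜ.indicator (fun ω => (T ω k).errX p q) ω +
      (valueEvent p q T k)ᶜ.indicator (fun ω => (T ω k).errFinal p q) ω) ∂P ≤
      ∫ ω in S, decayRate q ν * (T ω k).ε ∂P := by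
  have hpf : 0 < q.pf + q.pf := by linarith [hq.pf_mem.1]
  have hV := hmodel.likely_valueEvent hq k
  rw [← Real.sq_sqrt hpf.le] at hV
  have hs := Real.sqrt_pos.2 hpf
  have hε := (hmodel.meas_ε k).mono (hmodel.le_half k) le_rfl
  have hlo : 0 < q.ε₀ / q.γ ^ k := div_pos hq.ε₀_pos (pow_pos (zero_lt_one.trans hq.one_lt_γ) k)
  have hεlo : ∀ᵐ ω ∂P, q.ε₀ / q.γ ^ k ≤ (T ω k).ε := hrun.mono fun ω h =>
    (h.reliability_bounds hq k).1
  have hεhi : ∀ᵐ ω ∂P, (T ω k).ε ≤ q.ε₀ * q.γ ^ k := hrun.mono fun ω h =>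
    (h.reliability_bounds hq k).2
  have h1 := integral_error_indicator_le (hmodel.half_le_total k) hs hV hS
    (fun ω => Iteration.errX_nonneg) (hmodel.int_errX k) hε hlo hεlo hεhi (hmodel.var_errX k)
  have h2 := integral_error_indicator_le (hmodel.half_le_total k) hs hV hS
    (fun ω => Iteration.errFinal_nonneg) (hmodel.int_errFinal k) hε hlo hεlo hεhi
    (hmodel.var_errFinal k)
  have hεi : Integrable (fun ω => (T ω k).ε) P :=
    Integrable.of_bound (hε.mono (hmodel.half_le_total k) le_rfl).aestronglyMeasurable
      (q.ε₀ * q.γ ^ k) (by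
        filter_upwards [hεlo, hεhi] with ω e1 e2
        rwa [Real.norm_of_nonneg (hlo.le.trans e1)])
  refine ⟨(h1.1.add h2.1).const_mul ν, hεi.const_mul _, ?_⟩
  rw [integral_const_mul, integral_const_mul, integral_add h1.1.integrableOn h2.1.integrableOn]
  have h3 : 0 ≤ ∫ ω in S, (T ω k).ε ∂P := setIntegral_nonneg_of_ae (by
    filter_upwards [hεlo] with ω e using hlo.le.trans e)
  have h4 := mul_le_mul_of_nonneg_right (sqrt_two_pf_le hq hν hprob) h3
  have h5 := mul_le_mul_of_nonneg_left (add_le_add h1.2 h2.2) hν.1.le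
  linarith

/-- Gains that are bounded by the decrease of the potential function are summable in
expectation. -/
lemma summable_integral_gain (hq : q.Valid) (hrun : ∀ᵐ ω ∂P, IsRun p q x₀ (T ω))
    (hmodel : IsRandomModel p q P ℱ 𝒢 T) (hreg : Regularity p K O)
    (hbounds : ∀ᵐ ω ∂P, IterateBounds p q K O (T ω)) (hν : WeightCond m q K ν)
    (hprob : q.ph + q.pg + 2 * q.pf ≤ (1 - ν) ^ 2 / (16 * ν ^ 2) * (1 - 1 / q.γ) ^ 2)
    (k₀ : ℕ) {W : ℕ → Ω → ℝ} (hW : ∀ k, Integrable (W k) P) (hW0 : ∀ k, ∀ᵐ ω ∂P, 0 ≤ W k ω)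
    (hWle : ∀ k, k₀ ≤ k → ∀ᵐ ω ∂P, ω ∈ stableEvent K T k₀ (k + 1) →
      W k ω ≤ decayRate q ν * (T ω k).Δ ^ ((q.α : ℕ) + 2) ∨
      (ω ∈ valueEvent p q T k ∧ (T ω k).Successful p q ∧
        W k ω ≤ ν * q.η / 4 * -(T ω k).pred p q)) :
    Summable fun k => ∫ ω in stableEvent K T k₀ (k₀ + k + 1), W (k₀ + k) ω ∂P := by
  obtain ⟨Nf, hNf⟩ := exists_f_iterate_le p x₀ hq hreg k₀
  have hν0 := hν.1.1
  have h1ν : 0 < 1 - ν := by linarith [hν.1.2]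
  have hdr := (decayRate_pos hq hν).le
  have hS : ∀ k, MeasurableSet[𝒢 (k₀ + k)] (stableEvent K T k₀ (k₀ + k + 1)) := fun k =>
    hmodel.measurableSet_stableEvent (Nat.le_add_right k₀ k)
  have hnoise := fun k => integral_noise_le hq hrun hmodel hν.1 hprob (hS k)
  -- The merit parameter in `Φ` is truncated at `|K.μhat|`, so `Φ 0` is bounded almost surely
  -- everywhere, while on the stable event the truncation changes nothing. The radius part of the
  -- decay or the surplus predicted reduction pays for `W`, and the reliability part for the noise.
  refine summable_integral_of_drift (S := fun k => stableEvent K T k₀ (k₀ + k + 1))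
    (W := fun k => W (k₀ + k))
    (Φ := fun k ω => potential p q K ν (min (T ω k₀).μ |K.μhat|) (T ω (k₀ + k)))
    (N := ν * (Nf - K.fInf + |K.μhat| * K.κc) +
      (1 - ν) / 2 * (q.Δmax ^ ((q.α : ℕ) + 2) + q.ε₀ * q.γ ^ k₀))
    (fun i j hij => stableEvent_antitone k₀ (by lia))
    (fun k => hmodel.half_le_total _ _ (hS k)) ?_ (fun k => ?_) (fun k => hW _) (fun k => hW0 _)
    (fun k => (hnoise k).1) (fun k => Eventually.of_forall fun ω => ?_)
    (fun k => (hnoise k).2.1) (fun k => ?_) (fun k => (hnoise k).2.2) (fun k => ?_)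
  · filter_upwards [hrun, hbounds] with ω hT hB
    have h1 := hNf _ hT hB
    have h2 : min (T ω k₀).μ |K.μhat| * ‖p.c (T ω k₀).x‖ ≤ |K.μhat| * K.κc :=
      mul_le_mul (min_le_right _ _) (hB.c_le k₀) (norm_nonneg _) (abs_nonneg _)
    have h3 := pow_le_pow_left₀ (hT.radius_pos hq k₀).le (hT.radius_bounds hq k₀).2
      ((q.α : ℕ) + 2)
    have h4 := (hT.reliability_bounds hq k₀).2
    rw [add_zero, potential]
    gcongr
  · filter_upwards [hrun, hbounds] with ω hT hB
    exact potential_nonneg hreg hν (le_min (hT.merit_pos hq k₀).le (abs_nonneg _))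
      (hB.x_mem _) (hT.radius_pos hq _).le (hT.reliability_pos hq _).le
  · exact mul_nonneg hν0.le (add_nonneg
      (Set.indicator_nonneg (fun _ _ => Iteration.errX_nonneg) _)
      (Set.indicator_nonneg (fun _ _ => Iteration.errFinal_nonneg) _))
  · filter_upwards [hrun] with ω hT
    exact mul_nonneg hdr (hT.reliability_pos hq _).le
  · filter_upwards [hrun, hbounds, hWle (k₀ + k) (Nat.le_add_right k₀ k)] with ω hT hB hw hω
    have hμ : min (T ω k₀).μ |K.μhat| = (T ω (k₀ + k)).μ := by
      rw [min_eq_left (hω.1.trans (le_abs_self _))]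
      exact (hω.2 _ (Nat.le_add_right k₀ k) (Nat.lt_succ_self _)).symm
    have hv := hT.valid (k₀ + k)
    have hΔ := hT.radius_pos hq (k₀ + k)
    have hle := (hT.radius_bounds hq (k₀ + k)).2
    have hε := hT.reliability_pos hq (k₀ + k)
    have hnx := hT.next (k₀ + k)
    have hnxΔ := (hT.radius_pos hq (k₀ + k + 1)).le
    have hΔε : 0 ≤ decayRate q ν * (T ω (k₀ + k)).Δ ^ ((q.α : ℕ) + 2) :=
      mul_nonneg hdr (pow_nonneg hΔ.le _)
    rw [hμ, ← add_assoc]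
    by_cases hV : ω ∈ valueEvent p q T (k₀ + k)
    · rw [Set.indicator_of_notMem (Set.notMem_compl_iff.2 hV),
        Set.indicator_of_notMem (Set.notMem_compl_iff.2 hV)]
      rcases hw hω with hw | ⟨-, hs, hw⟩
      · have := potential_le_of_accurate hq hreg hν hv hΔ hle hε hnx hnxΔ hV.1 hV.2
        linarith
      · have := potential_le_of_successful_of_accurate hq hreg hν hv hΔ hle hε hnx hnxΔ hs
          hV.1 hV.2
        linarith
    · rw [Set.indicator_of_mem hV, Set.indicator_of_mem hV]
      rcases hw hω with hw | ⟨hV', -, -⟩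
      · have := potential_le hq hreg hν hv hΔ hle hε hnx hnxΔ
        linarith
      · exact absurd hV' hV

end Adapted

/-! ### Convergence -/

section Convergence

variable {d m : ℕ} {p : Problem d m} {q : Params} {K : Constants} {O : Set (Vec d)} {ν : ℝ}
  {x₀ : Vec d} {Ω : Type*} [mΩ : MeasurableSpace Ω] {P : Measure Ω}
  {ℱ 𝒢 : ℕ → MeasurableSpace Ω} {T : Ω → ℕ → Iteration d m}

/-- Almost surely, a large value of `ψ` at a radius below `δ` implies that an iteration with
accurate estimates is successful and has a predicted reduction proportional to the radius. -/
def SuccessThreshold (p : Problem d m) (q : Params) (K : Constants) (P : Measure Ω)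
    (T : Ω → ℕ → Iteration d m) (ψ : Vec d → ℝ) (ε δ : ℝ) : Prop :=
  ∀ᵐ ω ∂P, ∀ k₀ k, k₀ ≤ k → ω ∈ stableEvent K T k₀ (k + 1) → ω ∈ accurateEvent p q T k →
    (T ω k).Δ ≤ δ → ε ≤ ψ (T ω k).x →
    (T ω k).Successful p q ∧ q.κfcd * ε / 4 * (T ω k).Δ ≤ -(T ω k).pred p q

/-- The stable event supplies the bound on the merit parameter, so one deterministic radius works
for all outcomes and iterations. -/
lemma exists_successThreshold (hq : q.Valid) (hrun : ∀ᵐ ω ∂P, IsRun p q x₀ (T ω))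
    (hreg : Regularity p K O) (hbounds : ∀ᵐ ω ∂P, IterateBounds p q K O (T ω))
    {ψ : Vec d → ℝ} (hψ : ∀ᵐ ω ∂P, ∀ k, ψ (T ω k).x = p.kktResidual (T ω k).x)
    {ε : ℝ} (hε : 0 < ε) : ∃ δ, 0 < δ ∧ SuccessThreshold p q K P T ψ ε δ := by
  obtain ⟨δ, hδ, h⟩ := exists_radius_successful (p := p) (O := O) hq hreg hε
  refine ⟨δ, hδ, ?_⟩
  filter_upwards [hrun, hbounds, hψ] with ω hT hB hψω k₀ k hk hst hacc hle hres
  have hμ : (T ω k).μ = (T ω k₀).μ := hst.2 k hk (Nat.lt_succ_self k)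
  exact h (T ω k) (hT.valid k) (hB.boundedAt k) (hT.radius_pos hq k) (hT.radius_bounds hq k).2
    hle (fun hα => hB.H_le hα k) (hT.merit_pos hq k).le (hμ.le.trans hst.1)
    (hB.trial_mem k) hacc.2 hacc.1.1 (hψω k ▸ hres)

variable [IsProbabilityMeasure P]

lemma ae_tendsto_radius (hq : q.Valid) (hrun : ∀ᵐ ω ∂P, IsRun p q x₀ (T ω))
    (hmodel : IsRandomModel p q P ℱ 𝒢 T) (hreg : Regularity p K O)
    (hbounds : ∀ᵐ ω ∂P, IterateBounds p q K O (T ω)) (hν : WeightCond m q K ν)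
    (hprob : q.ph + q.pg + 2 * q.pf ≤ (1 - ν) ^ 2 / (16 * ν ^ 2) * (1 - 1 / q.γ) ^ 2)
    (k₀ : ℕ) :
    ∀ᵐ ω ∂P, (∀ k, ω ∈ stableEvent K T k₀ k) →
      Tendsto (fun k => (T ω k).Δ) atTop (𝓝 0) := by
  have hdr := decayRate_pos hq hν
  set W : ℕ → Ω → ℝ := fun k ω => decayRate q ν * (T ω k).Δ ^ ((q.α : ℕ) + 2) with hW
  have hW0 : ∀ k, ∀ᵐ ω ∂P, 0 ≤ W k ω := fun k => hrun.mono fun ω hT =>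
    mul_nonneg hdr.le (pow_nonneg (hT.radius_pos hq k).le _)
  have hWi : ∀ k, Integrable (W k) P := fun k => by
    refine Integrable.of_bound (((hmodel.meas_Δ k).mono (hmodel.le_total k) le_rfl).pow_const
      _ |>.const_mul _).aestronglyMeasurable (decayRate q ν * q.Δmax ^ ((q.α : ℕ) + 2)) ?_
    filter_upwards [hrun, hW0 k] with ω hT h0
    rw [Real.norm_of_nonneg h0]
    exact mul_le_mul_of_nonneg_left (pow_le_pow_left₀ (hT.radius_pos hq k).le
      (hT.radius_bounds hq k).2 _) hdr.le
  have hsum := summable_integral_gain hq hrun hmodel hreg hbounds hν hprob k₀ hWi hW0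
    (fun k _ => Eventually.of_forall fun ω _ => Or.inl le_rfl)
  filter_upwards [ae_summable_of_summable_integral (fun k => hmodel.half_le_total _ _
    (hmodel.measurableSet_stableEvent (Nat.le_add_right k₀ k))) (fun k => hWi (k₀ + k))
    (fun k => hW0 (k₀ + k)) hsum, hrun] with ω h hT hst
  have h1 := (h fun k => hst _).tendsto_atTop_zero
  have h2 : Tendsto (fun k => (T ω (k₀ + k)).Δ ^ ((q.α : ℕ) + 2)) atTop (𝓝 0) := by
    have h3 := h1.const_mul (decayRate q ν)⁻¹
    rw [mul_zero] at h3
    exact h3.congr fun k => inv_mul_cancel_left₀ hdr.ne' _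
  have h4 : Tendsto (fun k => (T ω (k₀ + k)).Δ) atTop (𝓝 0) := by
    refine tendsto_order.2 ⟨fun a ha => Eventually.of_forall fun k =>
      ha.trans (hT.radius_pos hq _), fun a ha => ?_⟩
    filter_upwards [h2.eventually (gt_mem_nhds (pow_pos ha ((q.α : ℕ) + 2)))] with k hk
    exact lt_of_pow_lt_pow_left₀ _ ha.le hk
  refine (tendsto_add_atTop_iff_nat k₀).1 (h4.congr fun k => ?_)
  rw [add_comm]

/-- The part of the radius that belongs to large values of `ψ` at small radii. -/
def largeRadius (T : Ω → ℕ → Iteration d m) (ψ : Vec d → ℝ) (ε δ : ℝ) (k : ℕ) : Ω → ℝ :=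
  {ω | ε ≤ ψ (T ω k).x ∧ (T ω k).Δ ≤ δ}.indicator fun ω => (T ω k).Δ

/-- On accurate iterations with large residual the surplus predicted reduction is a gain of order Δ,
hence summable in expectation. As the radius and the iterate are known before the estimates are
drawn, likelihood of accuracy transfers this to all iterations with large residual. -/
lemma ae_summable_largeRadius (hq : q.Valid) (hrun : ∀ᵐ ω ∂P, IsRun p q x₀ (T ω))
    (hmodel : IsRandomModel p q P ℱ 𝒢 T) (hreg : Regularity p K O)
    (hbounds : ∀ᵐ ω ∂P, IterateBounds p q K O (T ω)) (hν : WeightCond m q K ν)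
    (hprob : q.ph + q.pg + 2 * q.pf ≤ (1 - ν) ^ 2 / (16 * ν ^ 2) * (1 - 1 / q.γ) ^ 2)
    {ψ : Vec d → ℝ} (hψm : Measurable ψ) {ε δ : ℝ} (hε : 0 < ε)
    (hδ : SuccessThreshold p q K P T ψ ε δ) (k₀ : ℕ) :
    ∀ᵐ ω ∂P, (∀ k, ω ∈ stableEvent K T k₀ k) →
      Summable fun k => largeRadius T ψ ε δ k ω := by
  have hc : 0 < ν * q.η / 4 * (q.κfcd * ε / 4) := by
    have := hν.1.1
    have := hq.η_mem.1
    have := hq.κfcd_mem.1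
    positivity
  set c := ν * q.η / 4 * (q.κfcd * ε / 4) with hcdef
  set D := largeRadius T ψ ε δ with hD
  have hDm : ∀ k, Measurable[ℱ k] (D k) := fun k =>
    (hmodel.meas_Δ k).indicator
      ((measurableSet_le measurable_const (hψm.comp (hmodel.meas_x k))).inter
        (measurableSet_le (hmodel.meas_Δ k) measurable_const))
  have hD0 : ∀ k, ∀ᵐ ω ∂P, 0 ≤ D k ω := fun k => hrun.mono fun ω hT =>
    Set.indicator_apply_nonneg fun _ => (hT.radius_pos hq k).le
  have hDB : ∀ k, ∀ᵐ ω ∂P, D k ω ≤ q.Δmax := fun k => hrun.mono fun ω hT =>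
    Set.indicator_apply_le' (fun _ => (hT.radius_bounds hq k).2) fun _ => hq.Δmax_pos.le
  have hDi : ∀ k, Integrable (D k) P := fun k =>
    Integrable.of_bound ((hDm k).mono (hmodel.le_total k) le_rfl).aestronglyMeasurable q.Δmax (by
      filter_upwards [hD0 k, hDB k] with ω h1 h2
      rwa [Real.norm_of_nonneg h1])
  have hE := hmodel.likely_accurateEvent hq
  set W : ℕ → Ω → ℝ := fun k ω => c * (accurateEvent p q T k).indicator (D k) ω with hW
  have hWi : ∀ k, Integrable (W k) P := fun k => ((hDi k).indicator₀ (hE k).1).const_mul _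
  have hW0 : ∀ k, ∀ᵐ ω ∂P, 0 ≤ W k ω := fun k => (hD0 k).mono fun ω h =>
    mul_nonneg hc.le (Set.indicator_apply_nonneg fun _ => h)
  have hsum := summable_integral_gain hq hrun hmodel hreg hbounds hν hprob k₀ hWi hW0
    (fun k hk => by
      filter_upwards [hrun, hδ] with ω hT hω hst
      have hneg : 0 ≤ decayRate q ν * (T ω k).Δ ^ ((q.α : ℕ) + 2) :=
        mul_nonneg (decayRate_pos hq hν).le (pow_nonneg (hT.radius_pos hq k).le _)
      by_cases h1 : ω ∈ accurateEvent p q T k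
      · by_cases h2 : ω ∈ {ω | ε ≤ ψ (T ω k).x ∧ (T ω k).Δ ≤ δ}
        · obtain ⟨h3, h4⟩ := hω k₀ k hk hst h1 h2.2 h2.1
          refine Or.inr ⟨h1.1, h3, ?_⟩
          simp only [hW, hD, largeRadius, Set.indicator_of_mem h1, Set.indicator_of_mem h2]
          rw [hcdef, mul_assoc]
          exact mul_le_mul_of_nonneg_left h4
            (div_nonneg (mul_nonneg hν.1.1.le hq.η_mem.1.le) four_pos.le)
        · left
          simpa only [hW, hD, largeRadius, Set.indicator_of_mem h1, Set.indicator_of_notMem h2,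
            mul_zero] using hneg
      · left
        simpa only [hW, Set.indicator_of_notMem h1, mul_zero] using hneg)
  have hp1 : q.ph + q.pg + 2 * q.pf < 1 := by
    have h1 := failure_prob_lt hq hreg hν hprob
    have h2 := inv_pos.2 (zero_lt_one.trans hq.one_lt_γ)
    nlinarith [hq.ph_mem.1, hq.pg_mem.1, hq.pf_mem.1, hq.one_lt_γ]
  -- The index is shifted by one, because stable events are known from the past only after iteration
  -- `k₀`.
  have hsum' : Summable fun k => ∫ ω in stableEvent K T k₀ (k₀ + 1 + k + 1),
      (accurateEvent p q T (k₀ + 1 + k)).indicator (D (k₀ + 1 + k)) ω ∂P := by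
    have h1 := ((summable_nat_add_iff 1).2 hsum).mul_left c⁻¹
    refine h1.congr fun k => ?_
    simp only [hW]
    rw [integral_const_mul, inv_mul_cancel_left₀ hc.ne', ← add_assoc, add_right_comm k₀ k 1]
  have hfin := summable_integral_of_likely (ℱ := fun k => ℱ (k₀ + 1 + k))
    (C := fun k => stableEvent K T k₀ (k₀ + 1 + k)) (D := fun k => D (k₀ + 1 + k))
    (fun k => hmodel.le_total _) (fun i j hij => stableEvent_antitone k₀ (by lia))
    (fun k => hmodel.measurableSet_stableEvent' (by lia)) (fun k => hDm _) (fun k => hD0 _)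
    (fun k => hDB _) hp1 (fun k => hE _) hsum'
  filter_upwards [ae_summable_of_summable_integral (fun k => hmodel.le_total _ _
    (hmodel.measurableSet_stableEvent' (by lia))) (fun k => hDi (k₀ + 1 + k))
    (fun k => hD0 (k₀ + 1 + k)) hfin] with ω h hst
  refine (summable_nat_add_iff (k₀ + 1)).1 ((h fun k => hst _).congr fun k => ?_)
  rw [add_comm k]

/-- While the residual is large and the radius small, accuracy forces success, so 1/Δ is divided by
γ with high conditional probability and multiplied by at most γ otherwise. Its lower bound 1/Δmax
excludes that this lasts forever. Keeping Δ below Δmax/γ ensures that the cap is inactive and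
success multiplies Δ by exactly γ. -/
lemma ae_exists_small (hq : q.Valid) (hrun : ∀ᵐ ω ∂P, IsRun p q x₀ (T ω))
    (hmodel : IsRandomModel p q P ℱ 𝒢 T) (hreg : Regularity p K O) (hν : WeightCond m q K ν)
    (hprob : q.ph + q.pg + 2 * q.pf ≤ (1 - ν) ^ 2 / (16 * ν ^ 2) * (1 - 1 / q.γ) ^ 2)
    {ψ : Vec d → ℝ} (hψm : Measurable ψ) {ε δ : ℝ}
    (hδ : SuccessThreshold p q K P T ψ ε δ) (k₀ k₁ : ℕ) (hk : k₀ < k₁) :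
    ∀ᵐ ω ∂P, (∀ k, ω ∈ stableEvent K T k₀ k) →
      (∀ k, k₁ ≤ k → (T ω k).Δ ≤ min δ (q.Δmax / q.γ)) → ∃ k, k₁ ≤ k ∧ ψ (T ω k).x < ε := by
  have hγ := hq.one_lt_γ
  have hγ0 : 0 < q.γ := by linarith
  set A : ℕ → Set Ω := fun k =>
    {ω | ε ≤ ψ (T ω k).x} ∩ {ω | (T ω k).Δ ≤ min δ (q.Δmax / q.γ)} with hA
  have hAm : ∀ k, MeasurableSet[ℱ k] (A k) := fun k =>
    (measurableSet_le measurable_const (hψm.comp (hmodel.meas_x k))).inter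
      (measurableSet_le (hmodel.meas_Δ k) measurable_const)
  set R : ℕ → Set Ω := fun k => stableEvent K T k₀ (k₁ + k) ∩
    ⋂ j : ℕ, ⋂ _ : j ≤ k, A (k₁ + j) with hR
  have hRanti : Antitone R := fun i j hij ω hω =>
    ⟨stableEvent_antitone k₀ (by lia) hω.1, by
      simp only [Set.mem_iInter] at hω ⊢
      exact fun l hl => (Set.mem_iInter₂.1 hω.2) l (hl.trans hij)⟩
  have hRm : ∀ k, MeasurableSet[ℱ (k₁ + k)] (R k) := fun k =>
    (hmodel.measurableSet_stableEvent' (by lia)).inter (MeasurableSet.iInter fun j =>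
      MeasurableSet.iInter fun hj => hmodel.mono (by lia) _ (hAm (k₁ + j)))
  have hfinal := ae_exists_notMem_of_contraction (ℱ := fun k => ℱ (k₁ + k))
    (fun k => hmodel.le_total _) hRanti hRm (Y := fun k ω => (T ω (k₁ + k)).Δ⁻¹)
    (fun k => (hmodel.meas_Δ _).inv) (inv_pos.2 hq.Δmax_pos)
    (fun k => hrun.mono fun ω hT => inv_anti₀ (hT.radius_pos hq _) (hT.radius_bounds hq _).2)
    (B := fun k => (q.Δ₀ / q.γ ^ (k₁ + k))⁻¹)
    (fun k => hrun.mono fun ω hT => inv_anti₀ (div_pos hq.Δ₀_mem.1 (pow_pos hγ0 _))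
      (hT.radius_bounds hq _).1)
    (fun k => hmodel.likely_accurateEvent hq (k₁ + k)) hγ0 (failure_prob_lt hq hreg hν hprob)
    (fun k => by
      filter_upwards [hrun, hδ] with ω hT hω hRω
      have hΔ := hT.radius_pos hq (k₁ + k)
      have hAk : ω ∈ A (k₁ + k) := (Set.mem_iInter₂.1 hRω.2) k (Nat.le_succ k)
      have hsucc : (T ω (k₁ + k)).Successful p q →
          (T ω (k₁ + (k + 1))).Δ = q.γ * (T ω (k₁ + k)).Δ := fun hs => by
        rw [← add_assoc, (hT.next (k₁ + k)).Δ_succ hs, min_eq_left]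
        have h1 : (T ω (k₁ + k)).Δ ≤ q.Δmax / q.γ := hAk.2.trans (min_le_right _ _)
        rwa [le_div_iff₀ hγ0, mul_comm] at h1
      constructor
      · by_cases hs : (T ω (k₁ + k)).Successful p q
        · rw [hsucc hs, mul_inv]
          refine mul_le_mul_of_nonneg_right ?_ (inv_nonneg.2 hΔ.le)
          exact (inv_le_one_of_one_le₀ hγ.le).trans hγ.le
        · rw [← add_assoc, (hT.next (k₁ + k)).Δ_unsucc hs, inv_div, div_eq_mul_inv]
      · intro hacc
        have hs := (hω k₀ (k₁ + k) (by lia) hRω.1 hacc (hAk.2.trans (min_le_left _ _)) hAk.1).1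
        rw [hsucc hs, mul_inv])
  filter_upwards [hfinal] with ω ⟨k, hk'⟩ hst hrad
  by_contra! hno
  refine hk' ⟨hst _, Set.mem_iInter₂.2 fun j _ => ⟨hno _ (Nat.le_add_right _ _), ?_⟩⟩
  exact hrad _ (Nat.le_add_right _ _)

end Convergence

end TRSQP

end

theorem mainTheorem2 {d m : ℕ} (p : TRSQP.Problem d m) (q : TRSQP.Params) (hq : q.Valid)
    (x₀ : TRSQP.Vec d)
    {Ω : Type*} [MeasurableSpace Ω] (P : Measure Ω) [IsProbabilityMeasure P]
    (ℱ 𝒢 : ℕ → MeasurableSpace Ω) (T : Ω → ℕ → TRSQP.Iteration d m)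
    (hrun : ∀ᵐ ω ∂P, TRSQP.IsRun p q x₀ (T ω))
    (hmodel : TRSQP.IsRandomModel p q P ℱ 𝒢 T)
    (K : TRSQP.Constants) (O : Set (TRSQP.Vec d))
    (hreg : TRSQP.Regularity p K O)
    (hbounds : ∀ᵐ ω ∂P, TRSQP.IterateBounds p q K O (T ω))
    (hmerit : ∀ᵐ ω ∂P, TRSQP.MeritStabilizes K (T ω))
    (ν : ℝ) (hν : TRSQP.WeightCond m q K ν)
    (hprob : q.ph + q.pg + 2 * q.pf ≤
      (1 - ν) ^ 2 / (16 * ν ^ 2) * (1 - 1 / q.γ) ^ 2) :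
    ∀ᵐ ω ∂P, Tendsto (fun k => p.kktResidual (T ω k).x) atTop (𝓝 0) := by
  obtain ⟨L, hL⟩ := TRSQP.exists_lipschitzOnWith_kktResidual hreg
  -- The residual is controlled only at points with bounded data. A Lipschitz extension to the whole
  -- space agrees with it along the iterates and is measurable.
  obtain ⟨ψ, hψL, hψeq⟩ := hL.extend_real
  have hψ : ∀ᵐ ω ∂P, ∀ k, ψ (T ω k).x = p.kktResidual (T ω k).x := hbounds.mono
    fun ω hB k => (hψeq (hB.boundedAt k)).symm
  have hψm : Measurable ψ := hψL.continuous.measurable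
  have hn : ∀ n : ℕ, (0 : ℝ) < 1 / ((n : ℝ) + 1) := fun n => Nat.one_div_pos_of_nat
  -- Thresholds 1/(n+1), like starting indices, are taken from a countable set so that the
  -- exceptional null sets can be united.
  choose δ hδ0 hδ using fun n : ℕ =>
    TRSQP.exists_successThreshold hq hrun hreg hbounds hψ (hn n)
  have h1 := ae_all_iff.2 fun k₀ =>
    TRSQP.ae_tendsto_radius hq hrun hmodel hreg hbounds hν hprob k₀
  have h2 := ae_all_iff.2 fun n : ℕ => ae_all_iff.2 fun k₀ =>
    TRSQP.ae_summable_largeRadius hq hrun hmodel hreg hbounds hν hprob hψm (hn n) (hδ n) k₀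
  have h3 := ae_all_iff.2 fun n : ℕ => ae_all_iff.2 fun k₀ => ae_all_iff.2 fun j : ℕ =>
    TRSQP.ae_exists_small hq hrun hmodel hreg hν hprob hψm (hδ n) k₀ (k₀ + 1 + j) (by lia)
  filter_upwards [hrun, hbounds, hmerit, hψ, h1, h2, h3] with ω hT hB hM hψω e1 e2 e3
  obtain ⟨k₀, hk₀⟩ := hM
  have hst : ∀ k, ω ∈ TRSQP.stableEvent K T k₀ k := fun k =>
    ⟨(hk₀ k₀ le_rfl).2, fun j hj _ => (hk₀ j hj).1⟩
  have hlim := e1 k₀ hst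
  have hC := TRSQP.stepBound_pos hq hreg
  refine TRSQP.tendsto_zero_of_summable_on_large (Δ := fun k => (T ω k).Δ)
    (C := L * TRSQP.stepBound q K) (fun k => TRSQP.pairNorm_nonneg _ _)
    (mul_nonneg L.coe_nonneg hC.le) (fun k => (hT.radius_pos hq k).le) (fun k => ?_) hlim
    fun n => ⟨?_, ?_⟩
  · have h := (le_abs_self _).trans
      (hL.norm_sub_le (hB.boundedAt (k + 1)) (hB.boundedAt k))
    have h' := mul_le_mul_of_nonneg_left (hT.norm_x_sub_le hq hreg hB k) L.coe_nonneg
    linarith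
  · have hpos : 0 < min (δ n) (q.Δmax / q.γ) :=
      lt_min (hδ0 n) (div_pos hq.Δmax_pos (zero_lt_one.trans hq.one_lt_γ))
    obtain ⟨N, hN⟩ := eventually_atTop.1 (hlim.eventually (gt_mem_nhds hpos))
    refine frequently_atTop.2 fun a => ?_
    obtain ⟨k, hk, hlt⟩ := e3 n k₀ (N + a) hst fun k hk => (hN k (by lia)).le
    exact ⟨k, by lia, hψω k ▸ hlt⟩
  -- Once the radius stays below `δ n`, the radius condition in `largeRadius` is automatic and only
  -- the size of the residual is left.
  · obtain ⟨N, hN⟩ := eventually_atTop.1 (hlim.eventually (gt_mem_nhds (hδ0 n)))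
    refine (summable_nat_add_iff N).1 (((summable_nat_add_iff N).2 (e2 n k₀ hst)).congr
      fun k => ?_)
    have hiff : (ω ∈ {ω | 1 / ((n : ℝ) + 1) ≤ ψ (T ω (k + N)).x ∧ (T ω (k + N)).Δ ≤ δ n}) ↔
        k + N ∈ {k | 1 / ((n : ℝ) + 1) ≤ p.kktResidual (T ω k).x} := by
      rw [Set.mem_ofPred_eq, Set.mem_ofPred_eq]
      rw [hψω]
      exact and_iff_left (hN _ (Nat.le_add_left N k)).le
    simp only [TRSQP.largeRadius, Set.indicator_apply, hiff]
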